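/- Let $E/F$ be an unramified quadratic extension of non-archimedean local fields of odd residue characteristic, with Galois conjugation $x\mapsto\bar x$; let $q$ be the cardinality of the residue field of $F$, $\operatorname{val}$ the valuation on $E^\times$ extending the normalized valuation of $F$, and $\eta$ the quadratic character of $F^\times$ with kernel $\mathrm{Nm}(E^\times)$. Fix $\zeta\in\mathcal O_E^\times$ with $\bar\zeta=-\zeta$. Let $V_2=E^2$ with the split Hermitian form given by $J=\begin{pmatrix}0&\zeta\\-\zeta&0\end{pmatrix}$, $X^*=J\bar X^{T}J^{-1}$, $\mathcal{H}erm(V_2)=\{x: x=x^*\}$ and $\Lambda=\mathcal O_E^2$. Let $dg$ be the Haar measure on $U(V_2)$ for which the stabilizer $U(\Lambda)$ of $\Lambda$ has volume $1$. Let $\Phi=r_!\mathbf 1_{\mathrm{End}(\Lambda)}$ be the function on invertible elements of $\mathcal{H}erm(V_2)$ given by $\Phi(XX^*)=\int_{U(V_2)}\mathbf 1_{\mathrm{End}(\Lambda)}(Xh)\,dh$ for $X\in GL_2(E)$, and by $0$ on elements not of the form $XX^*$; let $\Phi_n$ be its restriction to $\{\operatorname{val}(\det)=n\}$, extended by $0$.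 For regular $\delta$ with compact centralizer $T_\delta\subset U(V_2)$, give $T_\delta$ volume $1$ and put $\mathrm{Orb}(\delta,f)=\int_{T_\delta\backslash U(V_2)}f(g^{-1}\delta g)\,d\dot g$. For $\delta$ with distinct eigenvalues $x,y\in F$ (so that $T_\delta\cong U(1)\times U(1)$) put $\mathrm{Orb}^\kappa(\delta,f)=\sum_{\delta'}\kappa(\mathrm{inv}(\delta,\delta'))\,\mathrm{Orb}(\delta',f)$, where $\delta'$ runs over the $U(V_2)$-conjugacy classes in $\mathcal{H}erm(V_2)$ that are $GL(V_2)$-conjugate (stably conjugate) to $\delta$, $\mathrm{inv}(\delta,\delta')\in H^1(F,T_\delta)\cong(F^\times/\mathrm{Nm}E^\times)^2$ is the class of the cocycle with value $g^{-1}\sigma(g)=g^{-1}(g^*)^{-1}$ at the non-trivial $\sigma\in\mathrm{Gal}(E/F)$, for any $g\in GL(V_2)$ with $\delta'=g\delta g^{-1}$, and $\kappa$ is the character which is trivial on the factor of the $x$-eigenline and non-trivial on the factor of the $y$-eigenline. Let $a,b\in F$ with $b\neq0$ and $a\neq\pm b$, put $n=\operatorname{val}(a^2-b^2)$, and let $$\delta_\pm=\begin{pmatrix}a&\lambda_\pm\zeta\\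 \mu_\pm\zeta&a\end{pmatrix}\in\mathcal{H}erm(V_2),\qquad \lambda_\pm,\mu_\pm\in F,\quad \eta(\mu_\pm)=\pm1,$$ both be stably conjugate to $\mathrm{diag}(a+b,a-b)$. Then all sums are finite, all the orbital integrals of $\Phi_n$ over the stable class converge absolutely, and (with $x=a+b$, $y=a-b$) $$\mathrm{Orb}^\kappa(\delta_+,\Phi_n)=\begin{cases}q^{\operatorname{val}(b)}&\text{if }\operatorname{val}(a+b)\text{ and }\operatorname{val}(a-b)\text{ are both even and non-negative},\\0&\text{otherwise.}\end{cases}$$ Moreover, write $n_1=\operatorname{val}(a)$ (with $n_1=\infty$ if $a=0$) and $n_2=\operatorname{val}(b)$, suppose $n_1,n_2\ge0$, and put $m=\min(n_1,n_2)$, $c_+=\lfloor\frac{1+m}{2}\rfloor$, $c_-=\lfloor\frac{2+m}{2}\rfloor$. 1. If $n_1>n_2$, then $n=2n_2$ and $\mathrm{Orb}(\delta_\pm,\Phi_n)=\sum_{k=0}^{n_2}\sum_{j=k}^{n_2}q^j-c_\pm q^{n_2}$. 2. If $n_1<n_2$, then $n=2n_1$ and $\mathrm{Orb}(\delta_\pm,\Phi_n)=\sum_{k=0}^{n_1}\sum_{j=k}^{n_2}q^j-c_\pm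 q^{n_2}$. 3. If $n_1=n_2$, then $n\ge 2n_2$; if $n$ is odd then $\mathrm{Orb}(\delta_\pm,\Phi_n)=0$, and if $n$ is even then $\mathrm{Orb}(\delta_\pm,\Phi_n)=\sum_{k=0}^{n_2}\sum_{j=k}^{n_2}q^j-c_\pm q^{n_2}$. -/

import Mathlib

open MeasureTheory ValuativeRel
open scoped Matrix WithZero ENNReal

noncomputable section

namespace UnitaryOrbital

/-! ### Local fields -/

section LocalField

/-- The normalized (additive) valuation of a non-archimedean local field, normalized so that a
uniformizer has valuation `1`. It is meaningful for `x ≠ 0` only (the value at `0` is `0`). -/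
def val (K : Type*) [Field K] [ValuativeRel K] [TopologicalSpace K] [IsNonarchimedeanLocalField K]
    (x : K) : ℤ :=
  -WithZero.log (IsNonarchimedeanLocalField.valueGroupWithZeroIsoInt K (valuation K x))

/-- The extension `E/F` of local fields is unramified: the normalized valuation of `E` extends that
of `F` (ramification index one; residue fields being finite, nothing else is needed). -/
def IsUnramified (F E : Type*) [Field F] [ValuativeRel F] [TopologicalSpace F]
    [IsNonarchimedeanLocalField F] [Field E] [ValuativeRel E] [TopologicalSpace E]
    [IsNonarchimedeanLocalField E] [Algebra F E] : Prop :=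
  ∀ x : F, val E (algebraMap F E x) = val F x

/-- `x ∈ F` lies in `Nm(E^×)`. -/
def IsNormUnit (F E : Type*) [Field F] [Field E] [Algebra F E] (x : F) : Prop :=
  ∃ z : E, z ≠ 0 ∧ Algebra.norm F z = x

open Classical in
/-- The quadratic character `η` of `F^×` attached to a quadratic extension `E/F` of local fields:
the character with kernel `Nm(E^×)`. -/
def eta (F E : Type*) [Field F] [Field E] [Algebra F E] (x : F) : ℤ :=
  if IsNormUnit F E x then 1 else -1

end LocalField

/-! ### The split Hermitian plane `V₂ = E²` -/

section Hermitian

variable {F E : Type*} [Field F] [Field E] [Algebra F E] (σ : E ≃ₐ[F] E) (ζ : E)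

/-- The matrix `J` of the split Hermitian form. -/
def formJ : Matrix (Fin 2) (Fin 2) E := !![0, ζ; -ζ, 0]

/-- The Hermitian pairing `⟨u, v⟩ = ūᵀ J v` on `V₂ = E²`. -/
def pairing (u v : Fin 2 → E) : E := (fun i => σ (u i)) ⬝ᵥ (formJ ζ *ᵥ v)

/-- The adjoint `X^* = J X̄ᵀ J⁻¹`. -/
def adj (X : Matrix (Fin 2) (Fin 2) E) : Matrix (Fin 2) (Fin 2) E :=
  formJ ζ * (X.map σ)ᵀ * (formJ ζ)⁻¹

/-- The Hermitian operators on `V₂`. -/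
def Herm : Set (Matrix (Fin 2) (Fin 2) E) :=
  {x | ∀ u v, pairing σ ζ (x *ᵥ u) v = pairing σ ζ u (x *ᵥ v)}

/-- The unitary group `U(V₂)`, as a subgroup of `GL₂(E)` (with the subspace topology when `E` is a
topological field). -/
def U2 : Subgroup (GL (Fin 2) E) where
  carrier := {g | ∀ u v, pairing σ ζ (g.1 *ᵥ u) (g.1 *ᵥ v) = pairing σ ζ u v}
  one_mem' := by intro u v; simp
  mul_mem' := by
    intro g h hg hh u v
    have := hg (h.1 *ᵥ u) (h.1 *ᵥ v)
    simp only [Matrix.mulVec_mulVec] at this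
    exact this.trans (hh u v)
  inv_mem' := by
    intro g hg u v
    have := hg ((g⁻¹).1 *ᵥ u) ((g⁻¹).1 *ᵥ v)
    simp only [Matrix.mulVec_mulVec, Units.mul_inv, Matrix.one_mulVec] at this
    exact this.symm

/-- The centralizer `T_δ` of `δ` in `U(V₂)`. -/
def centralizer (δ : Matrix (Fin 2) (Fin 2) E) : Subgroup (U2 σ ζ) where
  carrier := {t | t.1.1 * δ = δ * t.1.1}
  one_mem' := by simp
  mul_mem' := by
    intro s t hs ht
    change s.1.1 * t.1.1 * δ = δ * (s.1.1 * t.1.1)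
    rw [mul_assoc, show t.1.1 * δ = δ * t.1.1 from ht, ← mul_assoc,
      show s.1.1 * δ = δ * s.1.1 from hs, mul_assoc]
  inv_mem' := by
    intro t ht
    change (t.1⁻¹).1 * δ = δ * (t.1⁻¹).1
    rw [Units.inv_mul_eq_iff_eq_mul, ← mul_assoc, show t.1.1 * δ = δ * t.1.1 from ht, mul_assoc,
      Units.mul_inv, mul_one]

/-- The adjoint action `g δ g⁻¹` of `GL₂(E)`. -/
def conj (g : GL (Fin 2) E) (δ : Matrix (Fin 2) (Fin 2) E) : Matrix (Fin 2) (Fin 2) E :=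
  g.1 * δ * (g⁻¹).1

theorem conj_one (δ : Matrix (Fin 2) (Fin 2) E) : conj 1 δ = δ := by simp [conj]

theorem conj_mul (g h : GL (Fin 2) E) (δ : Matrix (Fin 2) (Fin 2) E) :
    conj (g * h) δ = conj g (conj h δ) := by simp [conj, mul_assoc]

/-- `δ` and `δ'` are stably conjugate. The group `U(V₂)` becomes `GL(V₂)` over `E`, so that for
elements of `Herm(V₂)` this is conjugacy under `GL(V₂) = GL₂(E)`. -/
def StablyConj (δ δ' : Matrix (Fin 2) (Fin 2) E) : Prop := ∃ g : GL (Fin 2) E, conj g δ = δ'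

/-- The elements of `Herm(V₂)` in the stable conjugacy class of `δ`. -/
def StableClass (δ : Matrix (Fin 2) (Fin 2) E) : Type _ :=
  {δ' : Matrix (Fin 2) (Fin 2) E // δ' ∈ Herm σ ζ ∧ StablyConj δ δ'}

/-- Rational conjugacy, that is, conjugacy under `U(V₂)`, on a stable conjugacy class. -/
def rationalConj (δ : Matrix (Fin 2) (Fin 2) E) : Setoid (StableClass σ ζ δ) where
  r x y := ∃ u : U2 σ ζ, conj u.1 x.1 = y.1
  iseqv :=
    { refl := fun x => ⟨1, conj_one x.1⟩
      symm := by
        rintro x y ⟨u, hu⟩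
        refine ⟨u⁻¹, ?_⟩
        change conj (u.1⁻¹) y.1 = x.1
        rw [← hu, ← conj_mul, inv_mul_cancel, conj_one]
      trans := by
        rintro x y z ⟨u, hu⟩ ⟨w, hw⟩
        refine ⟨w * u, ?_⟩
        change conj (w.1 * u.1) x.1 = z.1
        rw [conj_mul, hu, hw] }

/-- The set of rational conjugacy classes in the stable conjugacy class of `δ`. -/
abbrev RationalClasses (δ : Matrix (Fin 2) (Fin 2) E) : Type _ := Quotient (rationalConj σ ζ δ)

/-! ### The invariant and the character `κ`

Over `E` the group `U(V₂)` becomes `GL(V₂)`, and the non-trivial element of `Gal(E/F)` acts on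
`GL(V₂) = U(V₂)(E)` by `g ↦ (g^*)⁻¹`. For `δ ∈ Herm(V₂)` with distinct eigenvalues `x, y ∈ F` and
eigenlines `L_x, L_y`, a cocycle of `Gal(E/F)` with values in `T_δ(E)` is given by its value `t` at
the non-trivial element, which acts on `L_x` and on `L_y` by scalars in `F^×`; taking these scalars
modulo norms identifies `H¹(F, T_δ)` with `F^×/Nm(E^×) × F^×/Nm(E^×) = ℤ/2 × ℤ/2`. -/

/-- The value `g⁻¹ σ(g)` at the non-trivial element of `Gal(E/F)` of the cocycle attached to
`g ∈ GL(V₂)`. -/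
def galCocycle (g : GL (Fin 2) E) : Matrix (Fin 2) (Fin 2) E := (g⁻¹).1 * (adj σ ζ g.1)⁻¹

open Classical in
/-- The character of `H¹(F, T_δ) = ℤ/2 × ℤ/2` which is trivial on the factor of the eigenline of
the first eigenvalue and non-trivial on the factor of the eigenline of the second eigenvalue `y`,
evaluated at the class of the cocycle `t`. -/
def kappaTilde (δ : Matrix (Fin 2) (Fin 2) E) (y : F) (t : Matrix (Fin 2) (Fin 2) E) : ℤ :=
  if ∃ (v : Fin 2 → E) (c : F), v ≠ 0 ∧ δ *ᵥ v = algebraMap F E y • v ∧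
      t *ᵥ v = algebraMap F E c • v ∧ IsNormUnit F E c
  then 1 else -1

/-- `κ(inv(δ, δ'))` for `δ'` in the stable class of `δ`, where `inv(δ, δ')` is the class of the
cocycle `g⁻¹ σ(g)` for any `g ∈ GL(V₂)` with `δ' = g δ g⁻¹`. -/
def kappaInv (δ : Matrix (Fin 2) (Fin 2) E) (y : F) (δ' : StableClass σ ζ δ) : ℤ :=
  kappaTilde δ y (galCocycle σ ζ δ'.2.2.choose)

end Hermitian

/-! ### Orbital integrals -/

section Integrals

/-- For a compact subgroup `T` of `G` with Haar measure `dt` of total mass one, this is the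
invariant measure `dġ` on `T\G` with `dt dġ = dg`, where `dg = ν`
(see `lintegral_quotientMeasure`): the push-forward of `dg`. -/
def quotientMeasure {G : Type*} [Group G] [MeasurableSpace G] (T : Subgroup G) (ν : Measure G) :
    Measure (Quotient (QuotientGroup.rightRel T)) :=
  ν.map (Quotient.mk (QuotientGroup.rightRel T))

/-- The identity `∫_{T\G} ∫_T f(tg) dt dġ = ∫_G f(g) dg` characterizing the quotient measure. -/
theorem lintegral_quotientMeasure {G : Type*} [Group G] [MeasurableSpace G] [MeasurableMul G]
    (T : Subgroup G) (ν : Measure G) [SFinite ν] [ν.IsMulLeftInvariant]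
    (τ : Measure T) [IsProbabilityMeasure τ] (f : G → ℝ≥0∞)
    (hf : Measurable fun p : G × T => f (p.2.1 * p.1))
    (φ : Quotient (QuotientGroup.rightRel T) → ℝ≥0∞) (hφ : Measurable φ)
    (h : ∀ g : G, φ (Quotient.mk _ g) = ∫⁻ t : T, f (t.1 * g) ∂τ) :
    ∫⁻ x, φ x ∂(quotientMeasure T ν) = ∫⁻ g, f g ∂ν := by
  have hm : Measurable (Quotient.mk (QuotientGroup.rightRel T)) := measurable_quotient_mk''
  rw [quotientMeasure, lintegral_map hφ hm]
  simp_rw [h]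
  rw [lintegral_lintegral_swap hf.aemeasurable]
  simp_rw [lintegral_mul_left_eq_self f]
  simp

variable {F E : Type*} [Field F] [Field E] [Algebra F E] (σ : E ≃ₐ[F] E) (ζ : E)

/-- The function `T_δ g ↦ f(g⁻¹ δ g)` on `T_δ\U(V₂)`. -/
def orbitFun (δ : Matrix (Fin 2) (Fin 2) E) (f : Matrix (Fin 2) (Fin 2) E → ℂ) :
    Quotient (QuotientGroup.rightRel (centralizer σ ζ δ)) → ℂ :=
  Quotient.lift (fun g : U2 σ ζ => f (conj (g.1⁻¹) δ)) (by
    intro g h hgh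
    have hT : h * g⁻¹ ∈ centralizer σ ζ δ := QuotientGroup.rightRel_apply.mp hgh
    have hT' : (h * g⁻¹).1.1 * δ = δ * (h * g⁻¹).1.1 := hT
    have key : conj (h * g⁻¹).1 δ = δ := by
      rw [conj, hT', mul_assoc, Units.mul_inv, mul_one]
    have : conj (h.1⁻¹) δ = conj (g.1⁻¹) δ := by
      conv_lhs => rw [← key]
      rw [← conj_mul]
      simp
    simp only [this])

/-- The orbital integral `Orb(δ, f) = ∫_{T_δ\U(V₂)} f(g⁻¹ δ g) dġ`, for `δ` with compact
centralizer `T_δ` in `U(V₂)` and `T_δ` given total mass one. -/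
def orb [MeasurableSpace (U2 σ ζ)] (ν : Measure (U2 σ ζ)) (δ : Matrix (Fin 2) (Fin 2) E)
    (f : Matrix (Fin 2) (Fin 2) E → ℂ) : ℂ :=
  ∫ x, orbitFun σ ζ δ f x ∂(quotientMeasure (centralizer σ ζ δ) ν)

/-- The `κ`-orbital integral `Orb^κ(δ, f) = ∑_{δ' ∼ₛₜ δ} κ(inv(δ, δ')) Orb(δ', f)`, the sum being
over (representatives of) the rational classes in the stable class of `δ`; here `y` is the second
eigenvalue of `δ`, which determines `κ`. -/
def orbKappa [MeasurableSpace (U2 σ ζ)] (ν : Measure (U2 σ ζ)) (δ : Matrix (Fin 2) (Fin 2) E)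
    (y : F) (f : Matrix (Fin 2) (Fin 2) E → ℂ) : ℂ :=
  ∑ᶠ c : RationalClasses σ ζ δ, (kappaInv σ ζ δ y c.out : ℂ) * orb σ ζ ν c.out.1 f

open Classical in
/-- The push-forward `r_! f` of `f` along `r(X) = X X^*`, on invertible elements of `Herm(V₂)`:
`(r_! f)(X X^*) = ∫_{U(V₂)} f(X h) dh` for any `X ∈ GL₂(E)`, and `r_! f` is zero outside the image
of `r`. -/
def pushforward [MeasurableSpace (U2 σ ζ)] (ν : Measure (U2 σ ζ))
    (f : Matrix (Fin 2) (Fin 2) E → ℂ) (δ : Matrix (Fin 2) (Fin 2) E) : ℂ :=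
  if hX : ∃ X : GL (Fin 2) E, X.1 * adj σ ζ X.1 = δ then
    ∫ u : U2 σ ζ, f (hX.choose.1 * u.1.1) ∂ν
  else 0

end Integrals

section Lattice

variable {F E : Type*} [Field F] [Field E] [Algebra F E] [ValuativeRel E]

/-- `End(Λ)` for the self-dual lattice `Λ = 𝒪_E²` in `V₂`: the matrices with entries in `𝒪_E`. -/
def EndLattice (E : Type*) [Field E] [ValuativeRel E] : Set (Matrix (Fin 2) (Fin 2) E) :=
  {M | ∀ i j, M i j ∈ (valuation E).integer}

/-- `U(Λ)`, the hyperspecial maximal compact subgroup of `U(V₂)` stabilizing `Λ`. -/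
def ULattice (σ : E ≃ₐ[F] E) (ζ : E) : Set (U2 σ ζ) :=
  {u | u.1.1 ∈ EndLattice E ∧ (u.1⁻¹).1 ∈ EndLattice E}

open Classical in
/-- `Φ_n`, the restriction of `Φ = r_! 1_{End(Λ)}` to the `δ ∈ Herm(V₂)` with
`val(det δ) = n` (extended by zero). -/
def PhiN [TopologicalSpace E] [IsNonarchimedeanLocalField E] (σ : E ≃ₐ[F] E) (ζ : E)
    [MeasurableSpace (U2 σ ζ)] (ν : Measure (U2 σ ζ)) (n : ℤ)
    (δ : Matrix (Fin 2) (Fin 2) E) : ℂ :=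
  if δ ∈ Herm σ ζ ∧ δ.det ≠ 0 ∧ val E δ.det = n then
    pushforward σ ζ ν ((EndLattice E).indicator 1) δ
  else 0

end Lattice

/-- The element `(a, λζ; μζ, a)` of `Herm(V₂)`. -/
def deltaMat {F E : Type*} [Field F] [Field E] [Algebra F E] (ζ : E) (a μ l : F) :
    Matrix (Fin 2) (Fin 2) E :=
  !![algebraMap F E a, algebraMap F E l * ζ; algebraMap F E μ * ζ, algebraMap F E a]

end UnitaryOrbital

end

/-! Everything reduces to counting cosets of `U(Λ)`. Let `ϖ` be a uniformizer of `F` and write `D =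
ζ²`, a non-square unit of `F`. Hensel's lemma in odd residue characteristic shows that `x + yζ` has
valuation `min(val x, val y)`, and that `Nm(E^×)` consists of the elements of even valuation. So `η`
and `κ` become parity conditions.

Each `g ∈ U(V₂)` is an upper triangular matrix with parameters `ϖ^i`, `z ∈ F`, times an element of
`U(Λ)` (`iwasawa`), and the coset depends only on `i` and on `z` modulo `ϖ^(2i)`. A right
`U(Λ)`-invariant set cut out by `e ≤ i ≤ f` and `val z ≥ i + e` therefore has volume `1 + q + ⋯ +
q^(f-e)` (`measure_setOf`). This is used twice.

Push-forward (`pushforward_eq_sum`): if `val (det δ)` is odd then `Φ(δ) = 0`. If it is even, `δ`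
becomes upper triangular under some `k ∈ GL₂(𝒪_E)` acting by `δ ↦ k δ k^*`, has an explicit square
root `X` for `X ↦ X X^*`, and `Φ(δ)` is the sum of `q^k` over the `k ≥ 0` with `δ ∈ ϖ^k End(Λ)`.

Orbital integral (`integral_phiN`): since `T_δ` has mass one, it is the sum over `k ≥ 0` of `q^k`
times the volume of the `g` with `g⁻¹ δ g ∈ ϖ^k End(Λ)`. For `k ≤ val a` this volume is `1 + ⋯ +
q^(val b - k)`, without its last term when `val μ - k` is odd. Each missing term costs exactly
`q^(val b)`, and `c_±` is the number of `k ≤ m` where this happens.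

Finally, rational classes in the stable class are told apart by the Hermitian norm of the
`y`-eigenvector modulo `Nm(E^×)`. For `δ_±` this norm is `-2bDμ_±`, so there are two classes, with
`κ = ±1`, and the `κ`-orbital integral is the difference `(c_- - c_+) q^(val b)`. It is nonzero
exactly when `m` is even; as `m` is also the minimum of `val (a ± b)`, this matches the parity
condition of the theorem. -/

noncomputable section

namespace UnitaryOrbital

/-! ### The normalized valuation -/

section Valuation

variable {K : Type*} [Field K] [ValuativeRel K] [TopologicalSpace K] [IsNonarchimedeanLocalField K]

/-- `x` lies in the fractional ideal of elements of valuation at least `k`. -/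
def ValGE (k : ℤ) (x : K) : Prop := x = 0 ∨ k ≤ val K x

theorem isoInt_ne_zero {x : K} (hx : x ≠ 0) :
    IsNonarchimedeanLocalField.valueGroupWithZeroIsoInt K (valuation K x) ≠ 0 := by
  simpa using hx

theorem val_mul {x y : K} (hx : x ≠ 0) (hy : y ≠ 0) : val K (x * y) = val K x + val K y := by
  simp only [val, map_mul]
  rw [WithZero.log_mul (isoInt_ne_zero hx) (isoInt_ne_zero hy)]
  ring

theorem val_one : val K (1 : K) = 0 := by simp [val]

theorem val_inv (x : K) : val K x⁻¹ = -val K x := by simp [val]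

theorem val_neg (x : K) : val K (-x) = val K x := by simp [val, Valuation.map_neg]

theorem val_div {x y : K} (hx : x ≠ 0) (hy : y ≠ 0) : val K (x / y) = val K x - val K y := by
  rw [div_eq_mul_inv, val_mul hx (inv_ne_zero hy), val_inv, sub_eq_add_neg]

theorem val_zpow (x : K) (m : ℤ) : val K (x ^ m) = m * val K x := by
  simp [val, map_zpow₀, WithZero.log_zpow]

theorem val_pow (x : K) (m : ℕ) : val K (x ^ m) = m * val K x := by
  simpa using val_zpow x m

theorem valGE_iff {k : ℤ} {x : K} : ValGE k x ↔
    IsNonarchimedeanLocalField.valueGroupWithZeroIsoInt K (valuation K x) ≤ WithZero.exp (-k) := by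
  by_cases hx : x = 0
  · simp [ValGE, hx]
  · rw [← WithZero.log_le_iff_le_exp (isoInt_ne_zero hx)]
    simp only [ValGE, hx, false_or, val]
    constructor <;> intro h <;> linarith

theorem valGE_zero (k : ℤ) : ValGE k (0 : K) := Or.inl rfl

theorem valGE_of_ne {k : ℤ} {x : K} (hx : x ≠ 0) : ValGE k x ↔ k ≤ val K x := by
  simp [ValGE, hx]

theorem ValGE.mono {j k : ℤ} {x : K} (h : ValGE k x) (hjk : j ≤ k) : ValGE j x :=
  h.imp id hjk.trans

theorem ValGE.add {k : ℤ} {x y : K} (hx : ValGE k x) (hy : ValGE k y) : ValGE k (x + y) := by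
  rw [valGE_iff] at *
  refine le_trans ?_ (max_le hx hy)
  have hm := (IsNonarchimedeanLocalField.valueGroupWithZeroIsoInt K).strictMono.monotone
  rw [← hm.map_max]
  exact hm (Valuation.map_add _ _ _)

theorem ValGE.neg {k : ℤ} {x : K} (hx : ValGE k x) : ValGE k (-x) := by
  rw [valGE_iff] at *
  rwa [Valuation.map_neg]

theorem ValGE.sub {k : ℤ} {x y : K} (hx : ValGE k x) (hy : ValGE k y) : ValGE k (x - y) := by
  rw [sub_eq_add_neg]; exact hx.add hy.neg

theorem valGE_neg {k : ℤ} {x : K} : ValGE k (-x) ↔ ValGE k x :=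
  ⟨fun h => by simpa using h.neg, ValGE.neg⟩

theorem valGE_mul_iff {k : ℤ} {x y : K} (hy : y ≠ 0) : ValGE k (x * y) ↔ ValGE (k - val K y) x := by
  by_cases hx : x = 0
  · simp [ValGE, hx]
  · rw [valGE_of_ne hx, valGE_of_ne (mul_ne_zero hx hy), val_mul hx hy]
    constructor <;> intro h <;> linarith

theorem valGE_mul_iff' {k : ℤ} {x y : K} (hy : y ≠ 0) :
    ValGE k (y * x) ↔ ValGE (k - val K y) x := by
  rw [mul_comm, valGE_mul_iff hy]

theorem ValGE.mul {j k : ℤ} {x y : K} (hx : ValGE j x) (hy : ValGE k y) :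
    ValGE (j + k) (x * y) := by
  by_cases hy0 : y = 0
  · simp [ValGE, hy0]
  · rw [valGE_mul_iff hy0]
    rw [valGE_of_ne hy0] at hy
    exact hx.mono (by linarith)

theorem valGE_one : ValGE 0 (1 : K) := Or.inr (val_one (K := K)).ge

theorem mem_integer_iff {x : K} : x ∈ (valuation K).integer ↔ ValGE 0 x := by
  rw [valGE_iff, Valuation.mem_integer_iff]
  simp only [neg_zero, WithZero.exp_zero]
  rw [← map_one (IsNonarchimedeanLocalField.valueGroupWithZeroIsoInt K)]
  exact (OrderIsoClass.map_le_map_iff _).symm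

theorem val_surjective (m : ℤ) : ∃ x : K, x ≠ 0 ∧ val K x = m := by
  obtain ⟨x, hx⟩ := ValuativeRel.valuation_surjective
    ((IsNonarchimedeanLocalField.valueGroupWithZeroIsoInt K).symm (WithZero.exp (-m)))
  have h : IsNonarchimedeanLocalField.valueGroupWithZeroIsoInt K (valuation K x) =
      WithZero.exp (-m) := by simp [hx]
  refine ⟨x, ?_, by simp [val, h]⟩
  rintro rfl
  rw [map_zero, map_zero] at h
  exact WithZero.exp_ne_zero h.symm

/-- Otherwise `x = y - (y - x)` would have valuation above `val K x`. Since `val K 0 = 0` is a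
default value, `y ≠ 0` has to be recorded separately. -/
theorem val_eq_of_sub {x y : K} (hx : x ≠ 0) (h : ValGE (val K x + 1) (y - x)) :
    y ≠ 0 ∧ val K y = val K x := by
  have hy : ValGE (val K x) y := by
    have h1 := (h.mono (by linarith : val K x ≤ _)).add (Or.inr le_rfl : ValGE (val K x) x)
    simpa using h1
  have hn : ¬ ValGE (val K x + 1) y := by
    intro h'
    have h1 := h'.sub h
    rw [sub_sub_cancel, valGE_of_ne hx] at h1
    linarith
  have hy0 : y ≠ 0 := fun h0 => hn (Or.inl h0)
  rw [valGE_of_ne hy0] at hy hn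
  exact ⟨hy0, by linarith⟩

/-! ### The residue field -/

theorem residue_eq_zero_iff (x : (valuation K).integer) :
    IsLocalRing.residue _ x = 0 ↔ ValGE 1 (x : K) := by
  rw [IsLocalRing.residue_eq_zero_iff, IsLocalRing.mem_maximalIdeal, mem_nonunits_iff,
    (Valuation.integer.integers (valuation K)).isUnit_iff_valuation_eq_one]
  have hx := mem_integer_iff.1 x.2
  by_cases h0 : (x : K) = 0
  · simp [ValGE, h0, Algebra.algebraMap_eq_smul_one, Subring.smul_def]
  · rw [valGE_of_ne h0] at hx ⊢
    change ¬ valuation K (x : K) = 1 ↔ _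
    have : valuation K (x : K) = 1 ↔ val K (x : K) = 0 := by
      constructor
      · intro h; simp [val, h]
      · intro h
        have h1 : ValGE 0 (x : K)⁻¹ := Or.inr (by rw [val_inv, h]; simp)
        have h2 := mem_integer_iff.2 h1
        have h3 := x.2
        rw [Valuation.mem_integer_iff] at h2 h3
        rw [map_inv₀] at h2
        refine le_antisymm h3 ?_
        have h4 : valuation K (x : K) ≠ 0 := by simpa using h0
        exact (inv_le_one₀ (zero_lt_iff.2 h4)).1 h2
    rw [this]
    constructor
    · intro h; exact lt_of_le_of_ne hx (Ne.symm h)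
    · intro h; linarith

variable (K) in
/-- A lift of elements of the residue field, as an integer of the field. -/
def liftInteger (c : IsLocalRing.ResidueField (valuation K).integer) : (valuation K).integer :=
  Function.surjInv IsLocalRing.residue_surjective c

theorem residue_liftInteger (c : IsLocalRing.ResidueField (valuation K).integer) :
    IsLocalRing.residue _ (liftInteger K c) = c := Function.surjInv_eq _ c

variable (K) in
/-- A lift of elements of the residue field. -/
def lift (c : IsLocalRing.ResidueField (valuation K).integer) : K :=
  liftInteger K c

theorem valGE_lift (c : IsLocalRing.ResidueField (valuation K).integer) : ValGE 0 (lift K c) :=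
  mem_integer_iff.1 (liftInteger K c).2

theorem lift_injective {c d : IsLocalRing.ResidueField (valuation K).integer}
    (h : ValGE 1 (lift K c - lift K d)) : c = d := by
  have := (residue_eq_zero_iff
    (liftInteger K c - liftInteger K d)).2 h
  rw [map_sub, residue_liftInteger, residue_liftInteger] at this
  exact sub_eq_zero.1 this

theorem exists_lift {x : K} (hx : ValGE 0 x) : ∃ c, ValGE 1 (x - lift K c) := by
  refine ⟨IsLocalRing.residue _ ⟨x, mem_integer_iff.2 hx⟩, ?_⟩
  exact (residue_eq_zero_iff (⟨x, mem_integer_iff.2 hx⟩ - liftInteger K _)).1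
    (by rw [map_sub, residue_liftInteger, sub_self])

/-- Representatives of the quotient of two fractional ideals. -/
theorem exists_representatives (s : ℤ) (k : ℕ) : ∃ R : Finset K,
    R.card = Nat.card (IsLocalRing.ResidueField (valuation K).integer) ^ k ∧
    (∀ r ∈ R, ValGE s r) ∧ (∀ z, ValGE s z → ∃ r ∈ R, ValGE (s + k) (z - r)) ∧
    ∀ r ∈ R, ∀ r' ∈ R, ValGE (s + k) (r - r') → r = r' := by
  classical
  have hfin : Finite (IsLocalRing.ResidueField (valuation K).integer) :=
    inferInstanceAs (Finite (IsLocalRing.ResidueField (valuation K).integer))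
  have := Fintype.ofFinite (IsLocalRing.ResidueField (valuation K).integer)
  induction k with
  | zero =>
    refine ⟨{0}, by simp, by simp [valGE_zero], fun z hz => ⟨0, by simp, by simpa using hz⟩, ?_⟩
    simp
  | succ k ih =>
    obtain ⟨R, hc, h1, h2, h3⟩ := ih
    -- The next digit is a lifted residue class scaled by an element of valuation `s + k`; it
    -- multiplies the number of representatives by `q`.
    obtain ⟨p, hp0, hp⟩ := val_surjective (K := K) (s + k)
    have hpl : ∀ c, ValGE (s + k) (p * lift K c) := fun c => by
      rw [valGE_mul_iff' hp0, hp, sub_self]; exact valGE_lift c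
    -- At precision `s + k` the new digits vanish, so the old representatives agree; after
    -- cancelling them and dividing by `p`, the digits are compared in the residue field.
    have key : ∀ r ∈ R, ∀ r' ∈ R, ∀ c d,
        ValGE (s + (k + 1 : ℕ)) (r + p * lift K c - (r' + p * lift K d)) → r = r' ∧ c = d := by
      intro r hr r' hr' c d h
      have e : r = r' := by
        apply h3 r hr r' hr'
        have := ((h.mono (by push_cast; linarith : s + k ≤ _)).sub (hpl c)).add (hpl d)
        convert this using 1; ring
      refine ⟨e, ?_⟩
      subst e
      apply lift_injective
      rw [add_sub_add_left_eq_sub, ← mul_sub, valGE_mul_iff' hp0, hp] at h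
      convert h using 1; push_cast; ring
    refine ⟨(R ×ˢ Finset.univ).image fun x => x.1 + p * lift K x.2, ?_, ?_, ?_, ?_⟩
    · rw [Finset.card_image_of_injOn, Finset.card_product, hc, Finset.card_univ,
        Nat.card_eq_fintype_card, pow_succ]
      rintro ⟨r, c⟩ hr ⟨r', d⟩ hr' h
      simp only [Finset.coe_product, Finset.coe_univ, Set.mem_prod, Finset.mem_coe, Set.mem_univ,
        and_true] at hr hr' h
      obtain ⟨e1, e2⟩ := key r hr r' hr' c d (by rw [h, sub_self]; exact valGE_zero _)
      rw [e1, e2]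
    · intro r hr
      simp only [Finset.mem_image, Finset.mem_product, Finset.mem_univ, and_true] at hr
      obtain ⟨x, hx, rfl⟩ := hr
      exact (h1 _ hx).add ((hpl _).mono (by linarith))
    · intro z hz
      obtain ⟨r, hr, hzr⟩ := h2 z hz
      have : ValGE 0 ((z - r) / p) := by
        rw [div_eq_mul_inv, valGE_mul_iff (inv_ne_zero hp0), val_inv, hp]
        simpa using hzr
      obtain ⟨c, hcc⟩ := exists_lift this
      refine ⟨r + p * lift K c, Finset.mem_image.2 ⟨(r, c), by simp [hr], rfl⟩, ?_⟩
      have h5 : z - (r + p * lift K c) = p * ((z - r) / p - lift K c) := by field_simp; ring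
      rw [h5, valGE_mul_iff' hp0, hp]
      convert hcc using 1; push_cast; ring
    · intro r hr r' hr' h
      simp only [Finset.mem_image, Finset.mem_product, Finset.mem_univ, and_true] at hr hr'
      obtain ⟨x, hx, rfl⟩ := hr
      obtain ⟨y, hy, rfl⟩ := hr'
      obtain ⟨e1, e2⟩ := key _ hx _ hy _ _ h
      rw [e1, e2]

/-! ### Odd residue characteristic -/

theorem two_ne_zero_of_odd
    (hodd : ringChar (IsLocalRing.ResidueField (valuation K).integer) ≠ 2) :
    (2 : K) ≠ 0 ∧ val K (2 : K) = 0 := by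
  have h2 : (2 : IsLocalRing.ResidueField (valuation K).integer) ≠ 0 := Ring.two_ne_zero hodd
  have h3 : ¬ ValGE 1 (2 : K) := by
    intro h
    apply h2
    have := (residue_eq_zero_iff (2 : (valuation K).integer)).2 h
    rwa [map_ofNat] at this
  have h4 : ValGE 0 (2 : K) := by
    have := (valGE_one (K := K)).add valGE_one
    rwa [one_add_one_eq_two] at this
  have h0 : (2 : K) ≠ 0 := fun h => h3 (Or.inl h)
  refine ⟨h0, ?_⟩
  rw [valGE_of_ne h0] at h3 h4
  linarith

/-- Hensel's lemma for `X² - u` at the approximate root `1`, where the derivative is the unit `2`.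
-/
theorem isSquare_of_valGE_sub_one
    (hodd : ringChar (IsLocalRing.ResidueField (valuation K).integer) ≠ 2)
    {u : K} (hu : ValGE 1 (u - 1)) : ∃ s : K, s ^ 2 = u := by
  let _ := IsTopologicalAddGroup.rightUniformSpace K
  have := isUniformAddGroup_of_addCommGroup (G := K)
  have hu0 : ValGE 0 u := by simpa using (hu.mono zero_le_one).add valGE_one
  let w : (valuation K).integer := ⟨u, mem_integer_iff.2 hu0⟩
  have hH : HenselianRing (valuation K).integer
      (IsLocalRing.maximalIdeal (valuation K).integer) := inferInstance
  obtain ⟨s, hs, -⟩ := hH.is_henselian (Polynomial.X ^ 2 - Polynomial.C w)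
    (Polynomial.monic_X_pow_sub_C w two_ne_zero) 1 (by
      rw [← IsLocalRing.residue_eq_zero_iff, residue_eq_zero_iff]
      simp only [Polynomial.eval_sub, Polynomial.eval_pow, Polynomial.eval_X, one_pow,
        Polynomial.eval_C]
      simpa [w] using hu.neg) (by
      have h2 : (2 : IsLocalRing.ResidueField (valuation K).integer) ≠ 0 := Ring.two_ne_zero hodd
      have : Ideal.Quotient.mk (IsLocalRing.maximalIdeal (valuation K).integer)
          ((Polynomial.X ^ 2 - Polynomial.C w).derivative.eval 1) =
          (2 : IsLocalRing.ResidueField (valuation K).integer) := by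
        simp only [Polynomial.derivative_sub, Polynomial.derivative_X_pow, Polynomial.derivative_C,
          sub_zero, Polynomial.eval_mul, Polynomial.eval_C, Polynomial.eval_pow, Polynomial.eval_X,
          one_pow, mul_one]
        exact map_ofNat (IsLocalRing.residue (valuation K).integer) 2
      rw [this]
      exact IsUnit.mk0 _ h2)
  refine ⟨s, ?_⟩
  have := congrArg (Subtype.val) (hs : Polynomial.eval s _ = 0)
  simp [w] at this
  exact sub_eq_zero.1 this

/-- The sum of two scaled squares represents all units modulo the maximal ideal. -/
theorem exists_sq_sub_mul_sq
    (hodd : ringChar (IsLocalRing.ResidueField (valuation K).integer) ≠ 2)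
    {D u : K} (hD0 : D ≠ 0) (hD : val K D = 0) (hu : ValGE 0 u) :
    ∃ x y : K, ValGE 0 x ∧ ValGE 0 y ∧ ValGE 1 (x ^ 2 - D * y ^ 2 - u) := by
  have hfin : Finite (IsLocalRing.ResidueField (valuation K).integer) :=
    inferInstanceAs (Finite (IsLocalRing.ResidueField (valuation K).integer))
  have := Fintype.ofFinite (IsLocalRing.ResidueField (valuation K).integer)
  let d : (valuation K).integer := ⟨D, mem_integer_iff.2 (Or.inr hD.ge)⟩
  let w : (valuation K).integer := ⟨u, mem_integer_iff.2 hu⟩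
  have hd : IsLocalRing.residue _ d ≠ 0 := by
    rw [Ne, residue_eq_zero_iff, valGE_of_ne hD0]
    rw [hD]; norm_num
  -- Pigeonhole: over a field with an odd number `q` of elements a quadratic polynomial takes at
  -- least `(q + 1) / 2` values, so `f` and `-g` share a value.
  obtain ⟨x, y, hxy⟩ := FiniteField.exists_root_sum_quadratic
    (R := IsLocalRing.ResidueField (valuation K).integer)
    (f := Polynomial.X ^ 2 - Polynomial.C (IsLocalRing.residue _ w))
    (g := Polynomial.C (-IsLocalRing.residue _ d) * Polynomial.X ^ 2)
    (Polynomial.degree_X_pow_sub_C (by norm_num) _)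
    (Polynomial.degree_C_mul_X_pow 2 (neg_ne_zero.2 hd))
    (by rw [FiniteField.odd_card_of_char_ne_two]; exact hodd)
  obtain ⟨x, rfl⟩ := IsLocalRing.residue_surjective x
  obtain ⟨y, rfl⟩ := IsLocalRing.residue_surjective y
  refine ⟨x, y, mem_integer_iff.1 x.2, mem_integer_iff.1 y.2, ?_⟩
  have := (residue_eq_zero_iff (x ^ 2 - d * y ^ 2 - w)).1 (by
    simp at hxy
    simp
    linear_combination hxy)
  simpa [d, w] using this

end Valuation

/-! ### Unramified quadratic extensions -/

section Quadratic

variable {F E : Type*}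
  [Field F] [ValuativeRel F] [TopologicalSpace F] [IsNonarchimedeanLocalField F]
  [Field E] [ValuativeRel E] [TopologicalSpace E] [IsNonarchimedeanLocalField E]
  [Algebra F E]

/-- The extension `E/F` is unramified quadratic of odd residue characteristic, with non-trivial
automorphism `σ` and a unit `ζ` with `σ ζ = -ζ`. -/
structure UnramifiedQuadratic (σ : E ≃ₐ[F] E) (ζ : E) : Prop where
  finrank_eq : Module.finrank F E = 2
  unramified : IsUnramified F E
  odd : ringChar (IsLocalRing.ResidueField (valuation F).integer) ≠ 2
  ne_refl : σ ≠ AlgEquiv.refl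
  ne_zero : ζ ≠ 0
  val_eq : val E ζ = 0
  conj_eq : σ ζ = -ζ

namespace UnramifiedQuadratic

variable {σ : E ≃ₐ[F] E} {ζ : E} (H : UnramifiedQuadratic σ ζ)
include H

theorem two_ne_zero : (2 : F) ≠ 0 := (two_ne_zero_of_odd H.odd).1

theorem two_ne_zero' : (2 : E) ≠ 0 := by
  have := (map_ne_zero (algebraMap F E)).2 H.two_ne_zero
  rwa [map_ofNat] at this

theorem val_two : val F (2 : F) = 0 := (two_ne_zero_of_odd H.odd).2

theorem ne_algebraMap (x : F) : ζ ≠ algebraMap F E x := by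
  intro h
  have h1 := H.conj_eq
  rw [h, AlgEquiv.commutes, ← h] at h1
  have : 2 * ζ = 0 := by linear_combination h1
  exact (mul_ne_zero H.two_ne_zero' H.ne_zero) this

theorem exists_coord (z : E) : ∃ x y : F, z = algebraMap F E x + algebraMap F E y * ζ := by
  have hli : LinearIndependent F ![(1 : E), ζ] := by
    rw [LinearIndependent.pair_iff]
    intro s t h
    rw [Algebra.smul_def, Algebra.smul_def, mul_one] at h
    have ht : t = 0 := by
      by_contra ht
      have ht' : algebraMap F E t ≠ 0 := (map_ne_zero _).2 ht
      apply H.ne_algebraMap (-s / t)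
      rw [map_div₀, map_neg, eq_div_iff ht']
      linear_combination h
    subst ht
    simpa using h
  have hspan := hli.span_eq_top_of_card_eq_finrank (by simp [H.finrank_eq])
  have hz : z ∈ Submodule.span F (Set.range ![(1 : E), ζ]) := hspan ▸ Submodule.mem_top
  rw [Matrix.range_cons, Matrix.range_cons, Matrix.range_empty, Set.union_empty,
    Set.singleton_union, Submodule.mem_span_pair] at hz
  obtain ⟨x, y, h⟩ := hz
  exact ⟨x, y, by rw [← h, Algebra.smul_def, Algebra.smul_def, mul_one]⟩

theorem conj_coord (x y : F) :
    σ (algebraMap F E x + algebraMap F E y * ζ) =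
      algebraMap F E x + algebraMap F E (-y) * ζ := by
  simp [H.conj_eq]

theorem conj_conj (z : E) : σ (σ z) = z := by
  obtain ⟨x, y, rfl⟩ := H.exists_coord z
  rw [H.conj_coord, H.conj_coord, neg_neg]

theorem exists_of_conj_eq {z : E} (hz : σ z = z) : ∃ x : F, z = algebraMap F E x := by
  obtain ⟨x, y, rfl⟩ := H.exists_coord z
  rw [H.conj_coord] at hz
  refine ⟨x, ?_⟩
  have h : 2 * (algebraMap F E y * ζ) = 0 := by rw [map_neg] at hz; linear_combination -hz
  rw [(mul_eq_zero.1 h).resolve_left H.two_ne_zero', add_zero]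

theorem exists_of_conj_eq_neg {z : E} (hz : σ z = -z) : ∃ y : F, z = algebraMap F E y * ζ := by
  obtain ⟨x, y, rfl⟩ := H.exists_coord z
  rw [H.conj_coord] at hz
  refine ⟨y, ?_⟩
  have h : 2 * algebraMap F E x = 0 := by rw [map_neg] at hz; linear_combination hz
  rw [(mul_eq_zero.1 h).resolve_left H.two_ne_zero', zero_add]

/-- This presents `E` as `F(√D)` with `D` a non-square unit, so that norms from `E` are the values
of `x² - D y²`. -/
theorem exists_sq :
    ∃ D : F, algebraMap F E D = ζ ^ 2 ∧ D ≠ 0 ∧ val F D = 0 ∧ ∀ s : F, s ^ 2 ≠ D := by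
  obtain ⟨D, hD⟩ := H.exists_of_conj_eq (z := ζ ^ 2) (by rw [map_pow, H.conj_eq]; ring)
  refine ⟨D, hD.symm, ?_, ?_, ?_⟩
  · rintro rfl
    simp [H.ne_zero] at hD
  · rw [← H.unramified, ← hD, val_pow, H.val_eq, mul_zero]
  · rintro s rfl
    rw [map_pow] at hD
    rcases sq_eq_sq_iff_eq_or_eq_neg.1 hD with h | h
    · exact H.ne_algebraMap _ h
    · exact H.ne_algebraMap (-s) (by rw [map_neg, h])

/-- There are at most `[E : F] = 2` automorphisms, hence they are `1` and `σ`, the extension is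
Galois, and the norm is the product over both. -/
theorem algebraMap_norm (z : E) : algebraMap F E (Algebra.norm F z) = z * σ z := by
  classical
  have hfd : FiniteDimensional F E := Module.finite_of_finrank_pos (by rw [H.finrank_eq]; norm_num)
  have hsub : ({1, σ} : Finset (E ≃ₐ[F] E)) ⊆ Finset.univ := Finset.subset_univ _
  have h2 : ({1, σ} : Finset (E ≃ₐ[F] E)).card = 2 := Finset.card_pair (Ne.symm H.ne_refl)
  have hle : Fintype.card (E ≃ₐ[F] E) ≤ 2 := by
    rw [← H.finrank_eq]; exact AlgEquiv.card_le
  have huniv := Finset.eq_of_subset_of_card_le hsub (by rw [h2]; exact hle)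
  have hcard : Nat.card (E ≃ₐ[F] E) = Module.finrank F E := by
    rw [Nat.card_eq_fintype_card, ← Finset.card_univ, ← huniv, h2, H.finrank_eq]
  have := IsGalois.of_card_aut_eq_finrank F E hcard
  rw [Algebra.norm_eq_prod_automorphisms]
  have h3 : ∀ s : Finset (E ≃ₐ[F] E), s = {1, σ} → ∏ τ ∈ s, τ z = z * σ z := by
    rintro s rfl
    rw [Finset.prod_pair (show (1 : E ≃ₐ[F] E) ≠ σ from Ne.symm H.ne_refl)]; rfl
  apply h3
  convert huniv.symm

theorem valGE_algebraMap {k : ℤ} {x : F} : ValGE k (algebraMap F E x) ↔ ValGE k x := by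
  simp only [ValGE, map_eq_zero, H.unramified x]

theorem valGE_mul_zeta {k : ℤ} {z : E} : ValGE k (z * ζ) ↔ ValGE k z := by
  rw [valGE_mul_iff H.ne_zero, H.val_eq, sub_zero]

/-- Cancellation in `x + yζ` could occur only if `val x = val y`. Multiplying by the conjugate, it
would make `D (y/x)²` congruent to `1`, hence a square, and then `D` would be a square. -/
theorem valGE_coord_iff {k : ℤ} {x y : F} :
    ValGE k (algebraMap F E x + algebraMap F E y * ζ) ↔ ValGE k x ∧ ValGE k y := by
  constructor
  · intro h
    by_cases hx0 : x = 0
    · subst hx0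
      refine ⟨valGE_zero _, ?_⟩
      rw [map_zero, zero_add, H.valGE_mul_zeta, H.valGE_algebraMap] at h
      exact h
    by_cases hy0 : y = 0
    · subst hy0
      refine ⟨?_, valGE_zero _⟩
      rw [map_zero, zero_mul, add_zero, H.valGE_algebraMap] at h
      exact h
    have hx0' : algebraMap F E x ≠ 0 := (map_ne_zero _).2 hx0
    have hy0' : algebraMap F E y * ζ ≠ 0 := mul_ne_zero ((map_ne_zero _).2 hy0) H.ne_zero
    have hvy : val E (algebraMap F E y * ζ) = val F y := by
      rw [val_mul ((map_ne_zero _).2 hy0) H.ne_zero, H.val_eq, H.unramified, add_zero]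
    rw [valGE_of_ne hx0, valGE_of_ne hy0]
    rcases lt_trichotomy (val F x) (val F y) with hlt | heq | hlt
    · obtain ⟨h1, h2⟩ := val_eq_of_sub (y := algebraMap F E x + algebraMap F E y * ζ) hx0' (by
        rw [add_sub_cancel_left, valGE_of_ne hy0', hvy, H.unramified]; omega)
      rw [valGE_of_ne h1, h2, H.unramified] at h
      omega
    · by_contra hk
      have hk' : ValGE (val F x + 1) (algebraMap F E x + algebraMap F E y * ζ) :=
        h.mono (by omega)
      obtain ⟨D, hD, hD0, hDv, hDs⟩ := H.exists_sq
      have h1 : ValGE (val F x) (algebraMap F E x + algebraMap F E (-y) * ζ) := by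
        refine (H.valGE_algebraMap.2 (Or.inr le_rfl)).add ?_
        rw [map_neg, neg_mul, valGE_neg, valGE_of_ne hy0', hvy, heq]
      have h2 := hk'.mul h1
      have h3 : (algebraMap F E x + algebraMap F E y * ζ) *
          (algebraMap F E x + algebraMap F E (-y) * ζ) =
          algebraMap F E ((1 - D * y ^ 2 / x ^ 2) * x ^ 2) := by
        rw [sub_mul, div_mul_cancel₀ _ (pow_ne_zero 2 hx0)]
        simp only [map_sub, map_mul, map_pow, map_neg, hD, one_mul]
        ring
      rw [h3, H.valGE_algebraMap, valGE_mul_iff (pow_ne_zero 2 hx0), val_pow, ← valGE_neg,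
        neg_sub] at h2
      obtain ⟨s, hs⟩ := isSquare_of_valGE_sub_one H.odd (h2.mono (by push_cast; omega))
      apply hDs (s * x / y)
      rw [div_pow, mul_pow, hs]
      field_simp
    · obtain ⟨h1, h2⟩ := val_eq_of_sub (y := algebraMap F E x + algebraMap F E y * ζ) hy0' (by
        rw [add_sub_cancel_right, valGE_of_ne hx0', hvy, H.unramified]; omega)
      rw [valGE_of_ne h1, h2, hvy] at h
      omega
  · rintro ⟨hx, hy⟩
    exact (H.valGE_algebraMap.2 hx).add (H.valGE_mul_zeta.2 (H.valGE_algebraMap.2 hy))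

/-- Conjugation only changes the sign of the `ζ`-coordinate, and valuations are read off from the
coordinates. -/
theorem valGE_conj {k : ℤ} {z : E} : ValGE k (σ z) ↔ ValGE k z := by
  obtain ⟨x, y, rfl⟩ := H.exists_coord z
  rw [H.conj_coord, H.valGE_coord_iff, H.valGE_coord_iff, valGE_neg]

theorem val_conj (z : E) : val E (σ z) = val E z := by
  by_cases hz : z = 0
  · simp [hz]
  have hz' : σ z ≠ 0 := by simpa using hz
  apply le_antisymm
  · rw [← valGE_of_ne hz, ← H.valGE_conj, valGE_of_ne hz']
  · rw [← valGE_of_ne hz', H.valGE_conj, valGE_of_ne hz]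

/-- Dividing by an even power of a uniformizer leaves a unit `u`. A norm congruent to `u` exists by
the count over the residue field, and the error is a square, hence itself a norm. -/
theorem exists_mul_conj {x : F} (hx : x ≠ 0) (hv : Even (val F x)) :
    ∃ z : E, z ≠ 0 ∧ z * σ z = algebraMap F E x := by
  obtain ⟨m, hm⟩ := hv
  obtain ⟨p, hp0, hp⟩ := val_surjective (K := F) m
  obtain ⟨D, hD, hD0, hDv, hDs⟩ := H.exists_sq
  have hu0 : x / p ^ 2 ≠ 0 := div_ne_zero hx (pow_ne_zero 2 hp0)
  have hu : val F (x / p ^ 2) = 0 := by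
    rw [val_div hx (pow_ne_zero 2 hp0), val_pow, hp, hm]; push_cast; ring
  obtain ⟨a, b, -, -, hab⟩ := exists_sq_sub_mul_sq H.odd hD0 hDv (u := x / p ^ 2)
    ((valGE_of_ne hu0).2 hu.ge)
  set u := x / p ^ 2 with hudef
  have h1 : ValGE 1 ((a ^ 2 - D * b ^ 2) / u - 1) := by
    have : (a ^ 2 - D * b ^ 2) / u - 1 = (a ^ 2 - D * b ^ 2 - u) * u⁻¹ := by field_simp
    rw [this, valGE_mul_iff (inv_ne_zero hu0), val_inv, hu]
    simpa using hab
  obtain ⟨s, hs⟩ := isSquare_of_valGE_sub_one H.odd h1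
  have hs0 : s ≠ 0 := by
    rintro rfl
    rw [zero_pow (by norm_num)] at hs
    rw [← hs, zero_sub, valGE_neg, valGE_of_ne one_ne_zero, val_one] at h1
    omega
  have hx2 : x = (a ^ 2 - D * b ^ 2) * (p / s) ^ 2 := by
    rw [div_pow, hs, hudef]
    have hs2 := pow_ne_zero 2 hs0
    rw [hs] at hs2
    have : a ^ 2 - D * b ^ 2 ≠ 0 := fun h => hs2 (by rw [h, zero_div])
    field_simp
  have key : (algebraMap F E (p / s) * (algebraMap F E a + algebraMap F E b * ζ)) *
      σ (algebraMap F E (p / s) * (algebraMap F E a + algebraMap F E b * ζ)) =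
      algebraMap F E x := by
    rw [map_mul σ, AlgEquiv.commutes, H.conj_coord]
    conv_rhs => rw [hx2]
    simp only [map_sub, map_mul, map_pow, map_neg, hD]
    ring
  refine ⟨_, ?_, key⟩
  intro h0
  rw [h0, zero_mul] at key
  exact hx ((map_eq_zero (algebraMap F E)).1 key.symm)

theorem isNormUnit_iff {x : F} (hx : x ≠ 0) : IsNormUnit F E x ↔ Even (val F x) := by
  constructor
  · rintro ⟨z, hz, rfl⟩
    rw [← H.unramified, H.algebraMap_norm, val_mul hz (by simpa using hz), H.val_conj]
    exact ⟨_, rfl⟩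
  · intro h
    obtain ⟨z, hz, hzx⟩ := H.exists_mul_conj hx h
    refine ⟨z, hz, ?_⟩
    apply (algebraMap F E).injective
    rw [H.algebraMap_norm, hzx]

end UnramifiedQuadratic

end Quadratic

/-! ### The adjoint and the unitary group in coordinates -/

section Coordinates

variable {F E : Type*} [Field F] [Field E] [Algebra F E] {σ : E ≃ₐ[F] E} {ζ : E}

theorem pairing_eq (u v : Fin 2 → E) :
    pairing σ ζ u v = ζ * (σ (u 0) * v 1 - σ (u 1) * v 0) := by
  simp [pairing, formJ, dotProduct, Matrix.mulVec, Fin.sum_univ_two]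
  ring

theorem formJ_inv (hζ : ζ ≠ 0) : (formJ ζ)⁻¹ = !![0, -ζ⁻¹; ζ⁻¹, 0] := by
  apply Matrix.inv_eq_right_inv
  ext i j
  fin_cases i <;> fin_cases j <;> simp [formJ, Matrix.mul_apply, Fin.sum_univ_two, hζ]

theorem adj_eq (hζ : ζ ≠ 0) (X : Matrix (Fin 2) (Fin 2) E) :
    adj σ ζ X = !![σ (X 1 1), -σ (X 0 1); -σ (X 1 0), σ (X 0 0)] := by
  rw [adj, formJ_inv hζ]
  ext i j
  fin_cases i <;> fin_cases j <;>
    simp [formJ, Matrix.mul_apply, Matrix.vecMul, dotProduct, Fin.sum_univ_two] <;> field_simp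

theorem adj_mul (hζ : ζ ≠ 0) (X Y : Matrix (Fin 2) (Fin 2) E) :
    adj σ ζ (X * Y) = adj σ ζ Y * adj σ ζ X := by
  rw [adj_eq hζ, adj_eq hζ, adj_eq hζ]
  ext i j
  fin_cases i <;> fin_cases j <;> simp [Matrix.mul_apply, Fin.sum_univ_two] <;> ring

theorem adj_adj (hζ : ζ ≠ 0) (hσ : ∀ z, σ (σ z) = z) (X : Matrix (Fin 2) (Fin 2) E) :
    adj σ ζ (adj σ ζ X) = X := by
  rw [adj_eq hζ, adj_eq hζ]
  ext i j
  fin_cases i <;> fin_cases j <;> simp [hσ]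

theorem adj_one (hζ : ζ ≠ 0) : adj σ ζ (1 : Matrix (Fin 2) (Fin 2) E) = 1 := by
  rw [adj_eq hζ]
  ext i j
  fin_cases i <;> fin_cases j <;> simp

theorem det_adj (hζ : ζ ≠ 0) (X : Matrix (Fin 2) (Fin 2) E) : (adj σ ζ X).det = σ X.det := by
  rw [adj_eq hζ, Matrix.det_fin_two, Matrix.det_fin_two]
  simp
  ring

theorem pairing_mulVec (hζ : ζ ≠ 0) (X : Matrix (Fin 2) (Fin 2) E) (hσ : ∀ z, σ (σ z) = z)
    (u v : Fin 2 → E) : pairing σ ζ u (X *ᵥ v) = pairing σ ζ (adj σ ζ X *ᵥ u) v := by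
  rw [adj_eq hζ, pairing_eq, pairing_eq]
  congr 1
  simp [Matrix.mulVec, dotProduct, Fin.sum_univ_two, hσ]
  ring

theorem eq_of_pairing_eq (hζ : ζ ≠ 0) {X Y : Matrix (Fin 2) (Fin 2) E}
    (h : ∀ u v, pairing σ ζ u (X *ᵥ v) = pairing σ ζ u (Y *ᵥ v)) : X = Y := by
  ext i j
  fin_cases i
  · simpa [pairing_eq, hζ] using h ![0, 1] (Pi.single j 1)
  · simpa [pairing_eq, hζ] using h ![1, 0] (Pi.single j 1)

theorem mem_U2_iff (hζ : ζ ≠ 0) (hσ : ∀ z, σ (σ z) = z) (g : GL (Fin 2) E) :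
    g ∈ U2 σ ζ ↔ adj σ ζ g.1 * g.1 = 1 := by
  have hdef : g ∈ U2 σ ζ ↔ ∀ u v, pairing σ ζ (g.1 *ᵥ u) (g.1 *ᵥ v) = pairing σ ζ u v := Iff.rfl
  rw [hdef]
  have key : ∀ u v, pairing σ ζ (g.1 *ᵥ u) (g.1 *ᵥ v) =
      pairing σ ζ u ((adj σ ζ g.1 * g.1) *ᵥ v) := by
    intro u v
    rw [← Matrix.mulVec_mulVec, pairing_mulVec hζ (adj σ ζ g.1) hσ, adj_adj hζ hσ]
  simp only [key]
  constructor
  · intro h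
    exact eq_of_pairing_eq hζ fun u v => by rw [h, Matrix.one_mulVec]
  · intro h u v
    rw [h, Matrix.one_mulVec]

theorem mem_Herm_iff (hζ : ζ ≠ 0) (hσ : ∀ z, σ (σ z) = z) (δ : Matrix (Fin 2) (Fin 2) E) :
    δ ∈ Herm σ ζ ↔ adj σ ζ δ = δ := by
  have hdef : δ ∈ Herm σ ζ ↔
    ∀ u v, pairing σ ζ (δ *ᵥ u) v = pairing σ ζ u (δ *ᵥ v) := Iff.rfl
  have key : ∀ u v, pairing σ ζ (δ *ᵥ u) v = pairing σ ζ u (adj σ ζ δ *ᵥ v) := by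
    intro u v
    rw [pairing_mulVec hζ (adj σ ζ δ) hσ, adj_adj hζ hσ]
  rw [hdef]
  simp only [key]
  constructor
  · exact fun h => eq_of_pairing_eq hζ h
  · intro h u v
    rw [h]

theorem adj_mul_self (hζ : ζ ≠ 0) (hσ : ∀ z, σ (σ z) = z) (u : U2 σ ζ) :
    adj σ ζ u.1.1 * u.1.1 = 1 := (mem_U2_iff hζ hσ u.1).1 u.2

theorem adj_eq_inv (hζ : ζ ≠ 0) (hσ : ∀ z, σ (σ z) = z) (u : U2 σ ζ) :
    adj σ ζ u.1.1 = (u.1⁻¹).1 := by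
  rw [← mul_one (adj σ ζ u.1.1), ← Units.mul_inv u.1, ← mul_assoc, adj_mul_self hζ hσ, one_mul]

theorem conj_mem_Herm (hζ : ζ ≠ 0) (hσ : ∀ z, σ (σ z) = z) {δ : Matrix (Fin 2) (Fin 2) E}
    (hδ : δ ∈ Herm σ ζ) (u : U2 σ ζ) : conj u.1 δ ∈ Herm σ ζ := by
  rw [mem_Herm_iff hζ hσ] at hδ ⊢
  rw [conj, adj_mul hζ, adj_mul hζ, hδ, adj_eq_inv hζ hσ, ← adj_eq_inv hζ hσ, adj_adj hζ hσ,
    mul_assoc]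

theorem det_conj (g : GL (Fin 2) E) (δ : Matrix (Fin 2) (Fin 2) E) : (conj g δ).det = δ.det := by
  rw [conj, Matrix.det_mul, Matrix.det_mul, mul_right_comm, ← Matrix.det_mul, Units.mul_inv,
    Matrix.det_one, one_mul]

theorem trace_conj (g : GL (Fin 2) E) (δ : Matrix (Fin 2) (Fin 2) E) :
    (conj g δ).trace = δ.trace := by
  rw [conj, Matrix.trace_mul_comm, ← mul_assoc, Units.inv_mul, one_mul]

/-- The element `(w, z w⁻¹; 0, w⁻¹)` of `GL₂(E)`, for `w, z ∈ F`. -/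
def borelGL (E : Type*) [Field E] [Algebra F E] (w : Fˣ) (z : F) : GL (Fin 2) E where
  val := !![algebraMap F E w, algebraMap F E (z * (w : F)⁻¹); 0, algebraMap F E (w : F)⁻¹]
  inv := !![algebraMap F E (w : F)⁻¹, -algebraMap F E (z * (w : F)⁻¹); 0, algebraMap F E w]
  val_inv := by
    have hw : algebraMap F E (w : F) ≠ 0 := (map_ne_zero _).2 w.ne_zero
    ext i j
    fin_cases i <;> fin_cases j <;> simp [Matrix.mul_apply, Fin.sum_univ_two]
    field_simp; ring
  inv_val := by
    ext i j
    fin_cases i <;> fin_cases j <;> simp [Matrix.mul_apply, Fin.sum_univ_two]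
    field_simp; ring

variable (σ ζ) in
/-- The element `(w, z w⁻¹; 0, w⁻¹)` of `U(V₂)`, for `w, z ∈ F`. -/
def borel (w : Fˣ) (z : F) : U2 σ ζ := ⟨borelGL E w z, by
  intro u v
  have hw : algebraMap F E (w : F) ≠ 0 := (map_ne_zero _).2 w.ne_zero
  simp only [pairing_eq, borelGL, Matrix.mulVec, dotProduct, Fin.sum_univ_two]
  congr 1
  simp
  field_simp
  ring⟩

theorem borel_val (w : Fˣ) (z : F) : (borel σ ζ w z).1.1 =
    !![algebraMap F E w, algebraMap F E (z * (w : F)⁻¹); 0, algebraMap F E (w : F)⁻¹] := rfl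

theorem borel_inv_val (w : Fˣ) (z : F) : ((borel σ ζ w z).1⁻¹).1 =
    !![algebraMap F E (w : F)⁻¹, -algebraMap F E (z * (w : F)⁻¹); 0, algebraMap F E w] := rfl

end Coordinates

/-! ### The stabilizer of the lattice -/

section Lattice

section Algebraic

variable {F E : Type*} [Field F] [Field E] [ValuativeRel E] [Algebra F E]

theorem mul_mem_EndLattice {X Y : Matrix (Fin 2) (Fin 2) E} (hX : X ∈ EndLattice E)
    (hY : Y ∈ EndLattice E) : X * Y ∈ EndLattice E := by
  intro i j
  rw [Matrix.mul_apply]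
  exact sum_mem fun k _ => mul_mem (hX i k) (hY k j)

variable (E) in
theorem one_mem_EndLattice : (1 : Matrix (Fin 2) (Fin 2) E) ∈ EndLattice E := by
  intro i j
  rw [Matrix.one_apply]
  split_ifs
  · exact one_mem _
  · exact zero_mem _

/-- The subgroup `U(Λ)` of `U(V₂)`. -/
def latticeStabilizer (σ : E ≃ₐ[F] E) (ζ : E) : Subgroup (U2 σ ζ) where
  carrier := ULattice σ ζ
  one_mem' := by
    refine ⟨one_mem_EndLattice E, ?_⟩
    rw [show ((1 : U2 σ ζ).1)⁻¹ = 1 from inv_one]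
    exact one_mem_EndLattice E
  mul_mem' := by
    rintro g h ⟨hg, hg'⟩ ⟨hh, hh'⟩
    refine ⟨mul_mem_EndLattice hg hh, ?_⟩
    rw [show ((g * h).1)⁻¹ = h.1⁻¹ * g.1⁻¹ from mul_inv_rev _ _]
    exact mul_mem_EndLattice hh' hg'
  inv_mem' := by
    rintro g ⟨hg, hg'⟩
    refine ⟨hg', ?_⟩
    rw [show ((g⁻¹).1)⁻¹ = g.1 from inv_inv _]
    exact hg

theorem mem_latticeStabilizer {σ : E ≃ₐ[F] E} {ζ : E} {u : U2 σ ζ} :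
    u ∈ latticeStabilizer σ ζ ↔ u.1.1 ∈ EndLattice E ∧ (u.1⁻¹).1 ∈ EndLattice E := Iff.rfl

theorem mul_mem_EndLattice_iff {σ : E ≃ₐ[F] E} {ζ : E} {k : U2 σ ζ}
    (hk : k ∈ latticeStabilizer σ ζ) {X : Matrix (Fin 2) (Fin 2) E} :
    X * k.1.1 ∈ EndLattice E ↔ X ∈ EndLattice E := by
  refine ⟨fun h => ?_, fun h => mul_mem_EndLattice h hk.1⟩
  have := mul_mem_EndLattice h hk.2
  rwa [mul_assoc, Units.mul_inv, mul_one] at this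

end Algebraic

variable {F E : Type*} [Field F] [Field E] [ValuativeRel E] [TopologicalSpace E]
  [IsNonarchimedeanLocalField E] [Algebra F E]

theorem mem_EndLattice_iff {X : Matrix (Fin 2) (Fin 2) E} :
    X ∈ EndLattice E ↔ ∀ i j, ValGE 0 (X i j) :=
  forall_congr' fun _ => forall_congr' fun _ => mem_integer_iff

theorem isOpen_integer : IsOpen ((valuation E).integer : Set E) := by
  rw [isOpen_iff_mem_nhds]
  intro x hx
  rw [IsValuativeTopology.mem_nhds_iff]
  refine ⟨1, ?_⟩
  rintro _ ⟨z, hz, rfl⟩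
  refine add_mem hx ?_
  rw [Valuation.mem_integer_iff]
  exact le_of_lt (by simpa using hz)

theorem isOpen_latticeStabilizer (σ : E ≃ₐ[F] E) (ζ : E) :
    IsOpen (latticeStabilizer σ ζ : Set (U2 σ ζ)) := by
  have h : (latticeStabilizer σ ζ : Set (U2 σ ζ)) =
      (⋂ i, ⋂ j, {u : U2 σ ζ | u.1.1 i j ∈ (valuation E).integer}) ∩
        ⋂ i, ⋂ j, {u : U2 σ ζ | (u.1⁻¹).1 i j ∈ (valuation E).integer} := by
    ext u
    simp only [SetLike.mem_coe, mem_latticeStabilizer, Set.mem_inter_iff, Set.mem_iInter]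
    rfl
  rw [h]
  have hc1 : Continuous fun u : U2 σ ζ => u.1.1 := Units.continuous_val.comp continuous_subtype_val
  have hc2 : Continuous fun u : U2 σ ζ => (u.1⁻¹).1 :=
    Units.continuous_val.comp (continuous_inv.comp continuous_subtype_val)
  refine IsOpen.inter ?_ ?_ <;>
    refine isOpen_iInter_of_finite fun i => isOpen_iInter_of_finite fun j => ?_
  · exact isOpen_integer.preimage (hc1.matrix_elem i j)
  · exact isOpen_integer.preimage (hc2.matrix_elem i j)

end Lattice

/-! ### The Iwasawa decomposition -/

section Iwasawa

variable {F E : Type*}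
  [Field F] [ValuativeRel F] [TopologicalSpace F] [IsNonarchimedeanLocalField F]
  [Field E] [ValuativeRel E] [TopologicalSpace E] [IsNonarchimedeanLocalField E]
  [Algebra F E]

namespace UnramifiedQuadratic

variable {σ : E ≃ₐ[F] E} {ζ : E} (H : UnramifiedQuadratic σ ζ)
include H

theorem adj_mem_EndLattice {X : Matrix (Fin 2) (Fin 2) E} (hX : X ∈ EndLattice E) :
    adj σ ζ X ∈ EndLattice E := by
  rw [mem_EndLattice_iff] at hX ⊢
  rw [adj_eq H.ne_zero]
  intro i j
  fin_cases i <;> fin_cases j <;> simp [valGE_neg, H.valGE_conj, hX]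

/-- The inverse of a unitary matrix is its adjoint, whose entries are those of the matrix up to
place, sign and conjugation. -/
theorem mem_latticeStabilizer_iff {u : U2 σ ζ} :
    u ∈ latticeStabilizer σ ζ ↔ u.1.1 ∈ EndLattice E := by
  rw [mem_latticeStabilizer]
  refine ⟨And.left, fun h => ⟨h, ?_⟩⟩
  rw [← adj_eq_inv H.ne_zero H.conj_conj]
  exact H.adj_mem_EndLattice h

/-- The bottom row determines the decomposition: `-i` is its least valuation, and `z` is the
quotient of top by bottom entry in the column where this is attained. The other column is then
controlled by `det g`, which is a unit. -/
theorem iwasawa {p : Fˣ} (hp : val F (p : F) = 1) (g : U2 σ ζ) :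
    ∃ (i : ℤ) (z : F), (borel σ ζ (p ^ i) z)⁻¹ * g ∈ latticeStabilizer σ ζ := by
  have hg := adj_mul_self H.ne_zero H.conj_conj g
  have hg' := mul_eq_one_comm.1 hg
  have hdet := congrArg Matrix.det hg
  rw [Matrix.det_mul, det_adj H.ne_zero, Matrix.det_one] at hdet
  rw [adj_eq H.ne_zero] at hg hg'
  set a := g.1.1 0 0
  set b := g.1.1 0 1
  set c := g.1.1 1 0 with hc
  set d := g.1.1 1 1 with hd
  have hdet' : g.1.1.det = a * d - b * c := Matrix.det_fin_two _
  have hdet0 : a * d - b * c ≠ 0 := by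
    rw [← hdet']
    rintro h
    rw [h, mul_zero] at hdet
    exact zero_ne_one hdet
  have hdetv : val E (a * d - b * c) = 0 := by
    have := congrArg (val E) hdet
    rw [hdet', val_mul ((map_ne_zero σ).2 hdet0) hdet0, H.val_conj, val_one] at this
    linarith
  -- The columns of `g` are isotropic; this says that `a / c` and `b / d` are fixed by `σ`, hence
  -- lie in `F`.
  have h00 : σ a * c = σ c * a := by
    have := congrFun (congrFun hg 1) 0
    simp [Matrix.mul_apply, Fin.sum_univ_two] at this
    linear_combination this
  have h11 : σ b * d = σ d * b := by
    have := congrFun (congrFun hg 0) 1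
    simp [Matrix.mul_apply, Fin.sum_univ_two] at this
    linear_combination -this
  have hwv : ∀ i : ℤ, val F ((p ^ i : Fˣ) : F) = i := fun i => by
    rw [Units.val_zpow_eq_zpow_val, val_zpow, hp, mul_one]
  have hw0 : ∀ i : ℤ, algebraMap F E ((p ^ i : Fˣ) : F) ≠ 0 := fun i =>
    (map_ne_zero _).2 (Units.ne_zero _)
  -- Multiplication by the inverse of `borel` subtracts `z` times the bottom row from the top row,
  -- then scales the top row by `p^(-i)` and the bottom row by `p^i`.
  have key : ∀ (i : ℤ) (z : F), ValGE (-i) c → ValGE (-i) d →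
      ValGE i (a - algebraMap F E z * c) → ValGE i (b - algebraMap F E z * d) →
      (borel σ ζ (p ^ i) z)⁻¹ * g ∈ latticeStabilizer σ ζ := by
    intro i z h1 h2 h3 h4
    rw [H.mem_latticeStabilizer_iff, mem_EndLattice_iff]
    change ∀ k l, ValGE 0 ((((borel σ ζ (p ^ i) z).1⁻¹).1 * g.1.1) k l)
    rw [borel_inv_val]
    have e : ∀ x y : E, (algebraMap F E ((p ^ i : Fˣ) : F))⁻¹ * x
        - algebraMap F E z * (algebraMap F E ((p ^ i : Fˣ) : F))⁻¹ * y =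
        (algebraMap F E ((p ^ i : Fˣ) : F))⁻¹ * (x - algebraMap F E z * y) := by intros; ring
    have f : ∀ x : E, ValGE i x → ValGE 0 ((algebraMap F E ((p ^ i : Fˣ) : F))⁻¹ * x) := by
      intro x hx
      rw [valGE_mul_iff' (inv_ne_zero (hw0 i)), val_inv, H.unramified, hwv]
      simpa using hx
    have f' : ∀ x : E, ValGE (-i) x → ValGE 0 (algebraMap F E ((p ^ i : Fˣ) : F) * x) := by
      intro x hx
      rw [valGE_mul_iff' (hw0 i), H.unramified, hwv]
      simpa using hx
    have f3 := f _ h3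
    have f4 := f _ h4
    have f1 := f' _ h1
    have f2 := f' _ h2
    rw [← e] at f3 f4
    intro k l
    fin_cases k <;> fin_cases l <;>
      simp only [Matrix.mul_apply, Fin.sum_univ_two, Matrix.of_apply, Matrix.cons_val',
        Matrix.cons_val_zero, Matrix.cons_val_one, Matrix.cons_val_fin_one, map_mul, map_inv₀,
        Fin.zero_eta, Fin.mk_one, zero_mul, zero_add, neg_mul, ← sub_eq_add_neg]
    · exact f3
    · exact f4
    · exact f1
    · exact f2
  by_cases hcase : d ≠ 0 ∧ ValGE (val E d) c
  · obtain ⟨hd0, hcd⟩ := hcase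
    have hsd : σ d ≠ 0 := by simpa using hd0
    obtain ⟨z, hz⟩ := H.exists_of_conj_eq (z := b / d) (by
      rw [map_div₀, div_eq_div_iff hsd hd0, h11, mul_comm])
    refine ⟨-val E d, z, key _ z (by simpa using hcd) (Or.inr (by simp)) ?_ ?_⟩
    · have : a - algebraMap F E z * c = (a * d - b * c) / d := by
        rw [← hz]; field_simp
      rw [this]
      exact Or.inr (by rw [val_div hdet0 hd0, hdetv]; simp)
    · rw [← hz, div_mul_cancel₀ _ hd0, sub_self]
      exact valGE_zero _
  · have hc0 : c ≠ 0 := by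
      intro h0
      apply hcase
      refine ⟨?_, Or.inl h0⟩
      intro hd0
      rw [h0, hd0] at hdet0
      simp at hdet0
    have hdc : ValGE (val E c) d := by
      by_cases hd0 : d = 0
      · exact Or.inl hd0
      · rw [valGE_of_ne hd0]
        by_contra hlt
        exact hcase ⟨hd0, (valGE_of_ne hc0).2 (by omega)⟩
    have hsc : σ c ≠ 0 := by simpa using hc0
    obtain ⟨z, hz⟩ := H.exists_of_conj_eq (z := a / c) (by
      rw [map_div₀, div_eq_div_iff hsc hc0, h00, mul_comm])
    refine ⟨-val E c, z, key _ z (Or.inr (by simp)) (by simpa using hdc) ?_ ?_⟩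
    · rw [← hz, div_mul_cancel₀ _ hc0, sub_self]
      exact valGE_zero _
    · have : b - algebraMap F E z * d = -((a * d - b * c) / c) := by
        rw [← hz]; field_simp; ring
      rw [this, valGE_neg]
      exact Or.inr (by rw [val_div hdet0 hc0, hdetv]; simp)

/-- The diagonal entries of the quotient are `p^(j-i)` and `p^(i-j)`, so integrality forces `i = j`;
the corner is then `(y - z) p^(-2i)`. -/
theorem borel_inv_mul_mem_iff {p : Fˣ} (hp : val F (p : F) = 1) (i j : ℤ) (z y : F) :
    (borel σ ζ (p ^ i) z)⁻¹ * borel σ ζ (p ^ j) y ∈ latticeStabilizer σ ζ ↔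
      i = j ∧ ValGE (2 * i) (z - y) := by
  have hwv : ∀ i : ℤ, val F ((p ^ i : Fˣ) : F) = i := fun i => by
    rw [Units.val_zpow_eq_zpow_val, val_zpow, hp, mul_one]
  have hw0 : ∀ i : ℤ, ((p ^ i : Fˣ) : F) ≠ 0 := fun i => Units.ne_zero _
  rw [H.mem_latticeStabilizer_iff, mem_EndLattice_iff]
  have e : ((borel σ ζ (p ^ i) z)⁻¹ * borel σ ζ (p ^ j) y).1.1 =
      !![algebraMap F E (((p ^ i : Fˣ) : F)⁻¹ * ((p ^ j : Fˣ) : F)),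
        algebraMap F E ((y - z) * (((p ^ i : Fˣ) : F)⁻¹ * ((p ^ j : Fˣ) : F)⁻¹));
        0, algebraMap F E (((p ^ i : Fˣ) : F) * ((p ^ j : Fˣ) : F)⁻¹)] := by
    change ((borel σ ζ (p ^ i) z).1⁻¹).1 * (borel σ ζ (p ^ j) y).1.1 = _
    rw [borel_inv_val, borel_val]
    ext k l
    fin_cases k <;> fin_cases l <;> simp [Matrix.mul_apply, Fin.sum_univ_two]
    ring
  have v1 : ValGE 0 (((p ^ i : Fˣ) : F)⁻¹ * ((p ^ j : Fˣ) : F)) ↔ i ≤ j := by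
    rw [valGE_of_ne (mul_ne_zero (inv_ne_zero (hw0 i)) (hw0 j)),
      val_mul (inv_ne_zero (hw0 i)) (hw0 j), val_inv, hwv, hwv]
    omega
  have v2 : ValGE 0 (((p ^ i : Fˣ) : F) * ((p ^ j : Fˣ) : F)⁻¹) ↔ j ≤ i := by
    rw [valGE_of_ne (mul_ne_zero (hw0 i) (inv_ne_zero (hw0 j))),
      val_mul (hw0 i) (inv_ne_zero (hw0 j)), val_inv, hwv, hwv]
    omega
  have v3 : ValGE 0 ((y - z) * (((p ^ i : Fˣ) : F)⁻¹ * ((p ^ j : Fˣ) : F)⁻¹)) ↔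
      ValGE (i + j) (z - y) := by
    rw [valGE_mul_iff (mul_ne_zero (inv_ne_zero (hw0 i)) (inv_ne_zero (hw0 j))),
      val_mul (inv_ne_zero (hw0 i)) (inv_ne_zero (hw0 j)), val_inv, val_inv, hwv, hwv,
      ← valGE_neg, neg_sub]
    ring_nf
  rw [e]
  simp only [Fin.forall_fin_two, Matrix.of_apply, Matrix.cons_val', Matrix.cons_val_zero,
    Matrix.cons_val_one, Matrix.cons_val_fin_one, H.valGE_algebraMap]
  rw [v1, v2, v3]
  constructor
  · rintro ⟨⟨h1, h2⟩, -, h3⟩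
    have : i = j := le_antisymm h1 h3
    subst this
    exact ⟨rfl, by rwa [two_mul]⟩
  · rintro ⟨rfl, h⟩
    exact ⟨⟨le_rfl, by rwa [two_mul] at h⟩, valGE_zero _, le_rfl⟩

/-- The volume of a right `U(Λ)`-invariant set that is described by the conditions
`e ≤ i ≤ f` and `val z ≥ i + e` in terms of the Iwasawa decomposition. -/
theorem measure_setOf [MeasurableSpace (U2 σ ζ)] [BorelSpace (U2 σ ζ)]
    (ν : Measure (U2 σ ζ)) [ν.IsHaarMeasure] (hν : ν (ULattice σ ζ) = 1)
    {p : Fˣ} (hp : val F (p : F) = 1) (P : U2 σ ζ → Prop)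
    (hP : ∀ g, ∀ k ∈ latticeStabilizer σ ζ, P g → P (g * k)) (e f : ℤ)
    (h : ∀ i z, P (borel σ ζ (p ^ i) z) ↔ e ≤ i ∧ i ≤ f ∧ ValGE (i + e) z) :
    MeasurableSet {g | P g} ∧ ν {g | P g} =
      ∑ t ∈ Finset.range (f - e + 1).toNat,
        (Nat.card (IsLocalRing.ResidueField (valuation F).integer) : ℝ≥0∞) ^ t := by
  classical
  -- For `i = e + t` the condition reads `val z ≥ 2e + t`, while the coset depends on `z` modulo
  -- valuation `2i = 2e + 2t`. This leaves `q^t` cosets, each of volume one.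
  choose R hRc hR1 hR2 hR3 using fun t : ℕ => exists_representatives (K := F) (2 * e + t) t
  let b : (Σ _ : ℕ, F) → U2 σ ζ := fun x => borel σ ζ (p ^ (e + x.1)) x.2
  let C : (Σ _ : ℕ, F) → Set (U2 σ ζ) := fun x => (fun g => (b x)⁻¹ * g) ⁻¹' ULattice σ ζ
  let S : Finset (Σ _ : ℕ, F) := (Finset.range (f - e + 1).toNat).sigma R
  have hmem : ∀ x g, g ∈ C x ↔ (b x)⁻¹ * g ∈ latticeStabilizer σ ζ := fun _ _ => Iff.rfl
  have hmeas : ∀ x, MeasurableSet (C x) := fun x =>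
    (((isOpen_latticeStabilizer σ ζ).preimage (continuous_const_mul (b x)⁻¹))).measurableSet
  have hvol : ∀ x, ν (C x) = 1 := fun x => by rw [measure_preimage_mul, hν]
  have hset : {g | P g} = ⋃ x ∈ S, C x := by
    ext g
    simp only [Set.mem_iUnion, hmem, exists_prop]
    constructor
    · intro hg
      obtain ⟨i, z, hk⟩ := H.iwasawa hp g
      have hb : P (borel σ ζ (p ^ i) z) := by
        have := hP g _ (inv_mem hk) hg
        rwa [mul_inv_rev, inv_inv, mul_inv_cancel_left] at this
      obtain ⟨h1, h2, h3⟩ := (h i z).1 hb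
      obtain ⟨t, rfl⟩ : ∃ t : ℕ, i = e + t := ⟨(i - e).toNat, by omega⟩
      obtain ⟨r, hr, hzr⟩ := hR2 t z (by convert h3 using 1; ring)
      refine ⟨⟨t, r⟩, Finset.mem_sigma.2 ⟨Finset.mem_range.2
        (show t < (f - e + 1).toNat by omega), hr⟩, ?_⟩
      have h4 : (borel σ ζ (p ^ (e + t : ℤ)) r)⁻¹ * borel σ ζ (p ^ (e + t : ℤ)) z ∈
          latticeStabilizer σ ζ := by
        rw [H.borel_inv_mul_mem_iff hp]
        refine ⟨rfl, ?_⟩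
        rw [← valGE_neg, neg_sub]
        convert hzr using 1; ring
      have h5 := mul_mem h4 hk
      rwa [mul_assoc, mul_inv_cancel_left] at h5
    · rintro ⟨⟨t, r⟩, hx, hk⟩
      obtain ⟨ht, hr⟩ := Finset.mem_sigma.1 hx
      have ht' : t < (f - e + 1).toNat := Finset.mem_range.1 ht
      have hb : P (b ⟨t, r⟩) := by
        refine (h _ _).2 ⟨by simp, show e + (t : ℤ) ≤ f by omega, ?_⟩
        convert hR1 t r hr using 1
        simp only; ring
      have := hP _ _ hk hb
      rwa [mul_inv_cancel_left] at this
  have hdisj : Set.PairwiseDisjoint (S : Set (Σ _ : ℕ, F)) C := by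
    rintro ⟨t, r⟩ hx ⟨s, r'⟩ hy hxy
    rw [Function.onFun, Set.disjoint_left]
    intro g hg hg'
    apply hxy
    have h1 := mul_mem hg (inv_mem hg' : _ ∈ latticeStabilizer σ ζ)
    change (b ⟨t, r⟩)⁻¹ * g * ((b ⟨s, r'⟩)⁻¹ * g)⁻¹ ∈ latticeStabilizer σ ζ at h1
    rw [mul_inv_rev, inv_inv, mul_assoc, mul_inv_cancel_left] at h1
    obtain ⟨h2, h3⟩ := (H.borel_inv_mul_mem_iff hp _ _ _ _).1 h1
    have h4 : t = s := by simp only at h2; omega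
    subst h4
    have h5 := hR3 t r (Finset.mem_sigma.1 hx).2 r' (Finset.mem_sigma.1 hy).2 (by
      convert h3 using 1; simp only; ring)
    rw [h5]
  rw [hset]
  refine ⟨Finset.measurableSet_biUnion S fun x _ => hmeas x, ?_⟩
  rw [measure_biUnion_finset hdisj fun x _ => hmeas x]
  simp only [hvol, Finset.sum_const, nsmul_eq_mul, mul_one, S, Finset.card_sigma, hRc]
  push_cast
  rfl

end UnramifiedQuadratic

end Iwasawa

/-! ### Divisibility of matrices -/

section EntriesGE

variable {E : Type*} [Field E] [ValuativeRel E] [TopologicalSpace E] [IsNonarchimedeanLocalField E]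

/-- All entries of `X` have valuation at least `k`. -/
def EntriesGE (k : ℤ) (X : Matrix (Fin 2) (Fin 2) E) : Prop := ∀ i j, ValGE k (X i j)

theorem EntriesGE.mul {j k : ℤ} {X Y : Matrix (Fin 2) (Fin 2) E} (hX : EntriesGE j X)
    (hY : EntriesGE k Y) : EntriesGE (j + k) (X * Y) := by
  intro a b
  rw [Matrix.mul_apply, Fin.sum_univ_two]
  exact ((hX a 0).mul (hY 0 b)).add ((hX a 1).mul (hY 1 b))

theorem EntriesGE.mul_left {k : ℤ} {X Y : Matrix (Fin 2) (Fin 2) E} (hX : X ∈ EndLattice E)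
    (hY : EntriesGE k Y) : EntriesGE k (X * Y) := by
  have := EntriesGE.mul (mem_EndLattice_iff.1 hX) hY
  rwa [zero_add] at this

theorem EntriesGE.mul_right {k : ℤ} {X Y : Matrix (Fin 2) (Fin 2) E} (hX : EntriesGE k X)
    (hY : Y ∈ EndLattice E) : EntriesGE k (X * Y) := by
  have := EntriesGE.mul hX (mem_EndLattice_iff.1 hY)
  rwa [add_zero] at this

theorem valGE_det {X : Matrix (Fin 2) (Fin 2) E} {k : ℤ} (hX : EntriesGE k X) :
    ValGE (k + k) X.det := by
  rw [Matrix.det_fin_two]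
  exact ((hX 0 0).mul (hX 1 1)).sub ((hX 0 1).mul (hX 1 0))

theorem val_det_eq_zero {k : GL (Fin 2) E} (hk : k.1 ∈ EndLattice E)
    (hk' : (k⁻¹).1 ∈ EndLattice E) : k.1.det ≠ 0 ∧ val E k.1.det = 0 := by
  have h : k.1.det * (k⁻¹).1.det = 1 := by rw [← Matrix.det_mul, Units.mul_inv, Matrix.det_one]
  have h0 := left_ne_zero_of_mul_eq_one h
  have h0' := right_ne_zero_of_mul_eq_one h
  have h1 := valGE_det (mem_EndLattice_iff.1 hk)
  have h2 := valGE_det (mem_EndLattice_iff.1 hk')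
  rw [valGE_of_ne h0] at h1
  rw [valGE_of_ne h0'] at h2
  have h3 := congrArg (val E) h
  rw [val_mul h0 h0', val_one] at h3
  exact ⟨h0, by omega⟩

end EntriesGE

/-! ### The push-forward of the characteristic function of `End(Λ)` -/

namespace UnramifiedQuadratic

variable {F E : Type*}
  [Field F] [ValuativeRel F] [TopologicalSpace F] [IsNonarchimedeanLocalField F]
  [Field E] [ValuativeRel E] [TopologicalSpace E] [IsNonarchimedeanLocalField E]
  [Algebra F E] {σ : E ≃ₐ[F] E} {ζ : E} (H : UnramifiedQuadratic σ ζ)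
include H

theorem exists_entries {δ : Matrix (Fin 2) (Fin 2) E} (hδ : δ ∈ Herm σ ζ) :
    ∃ (x : E) (l m : F),
      δ = !![x, algebraMap F E l * ζ; algebraMap F E m * ζ, σ x] := by
  rw [mem_Herm_iff H.ne_zero H.conj_conj, adj_eq H.ne_zero] at hδ
  have h01 := congrFun (congrFun hδ 0) 1
  have h10 := congrFun (congrFun hδ 1) 0
  have h11 := congrFun (congrFun hδ 1) 1
  simp at h01 h10 h11
  obtain ⟨l, hl⟩ := H.exists_of_conj_eq_neg (z := δ 0 1) (neg_eq_iff_eq_neg.1 h01)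
  obtain ⟨m, hm⟩ := H.exists_of_conj_eq_neg (z := δ 1 0) (neg_eq_iff_eq_neg.1 h10)
  refine ⟨δ 0 0, l, m, ?_⟩
  rw [← hl, ← hm, h11]
  exact Matrix.eta_fin_two δ

theorem exists_det {δ : Matrix (Fin 2) (Fin 2) E} (hδ : δ ∈ Herm σ ζ) :
    ∃ d : F, δ.det = algebraMap F E d := by
  rw [mem_Herm_iff H.ne_zero H.conj_conj] at hδ
  apply H.exists_of_conj_eq
  rw [← det_adj H.ne_zero, hδ]

/-- A Hermitian operator whose determinant has even valuation is upper triangular after an integral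
change of basis. -/
theorem exists_isotropic {δ : Matrix (Fin 2) (Fin 2) E} (hδ : δ ∈ Herm σ ζ) (h0 : δ.det ≠ 0)
    (hev : Even (val E δ.det)) : ∃ k : GL (Fin 2) E, k.1 ∈ EndLattice E ∧ (k⁻¹).1 ∈ EndLattice E ∧
      (k.1 * δ * adj σ ζ k.1) 1 0 = 0 := by
  obtain ⟨d, hd⟩ := H.exists_det hδ
  obtain ⟨x, l, m, rfl⟩ := H.exists_entries hδ
  obtain ⟨D, hD, hD0, hDv, -⟩ := H.exists_sq
  have hζ := H.ne_zero
  by_cases hm : m = 0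
  · refine ⟨1, one_mem_EndLattice E, ?_, ?_⟩
    · rw [inv_one]; exact one_mem_EndLattice E
    · rw [Units.val_one, adj_one hζ, hm]
      simp
  have hm' : algebraMap F E m ≠ 0 := (map_ne_zero _).2 hm
  have hd0 : d ≠ 0 := by rintro rfl; simp [hd] at h0
  rw [hd, H.unramified] at hev
  -- For a bottom row `(1, y)` of `k` the lower left entry of `k δ k^*` is a quadratic expression in
  -- `y`. Completing the square by `z = y + x / (mζ)`, it vanishes when `z σ(z) = -det δ / (m² D)`,
  -- which is solvable because the right side has even valuation.
  obtain ⟨z, -, hz⟩ := H.exists_mul_conj (x := -d / (m ^ 2 * D))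
    (div_ne_zero (neg_ne_zero.2 hd0) (mul_ne_zero (pow_ne_zero 2 hm) hD0)) (by
      rw [val_div (neg_ne_zero.2 hd0) (mul_ne_zero (pow_ne_zero 2 hm) hD0),
        val_mul (pow_ne_zero 2 hm) hD0, val_neg, val_pow, hDv, add_zero]
      exact hev.sub ⟨val F m, by push_cast; ring⟩)
  have hdet : algebraMap F E d = x * σ x - algebraMap F E l * ζ * (algebraMap F E m * ζ) := by
    rw [← hd, Matrix.det_fin_two_of]
  rw [map_div₀, map_neg, map_mul, map_pow, hD, hdet] at hz
  obtain ⟨y, hy⟩ : ∃ y, y = z - x / (algebraMap F E m * ζ) := ⟨_, rfl⟩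
  have hzy : z = y + x / (algebraMap F E m * ζ) := by rw [hy]; ring
  have key : x * σ y + algebraMap F E m * ζ * (y * σ y) - algebraMap F E l * ζ - y * σ x = 0 := by
    rw [hzy, map_add, map_div₀, map_mul, AlgEquiv.commutes, H.conj_eq] at hz
    field_simp at hz
    have h2 : algebraMap F E m * ζ ≠ 0 := mul_ne_zero hm' hζ
    apply mul_left_cancel₀ h2
    rw [mul_zero]
    linear_combination hz
  -- The isotropic row may be rescaled: `(1, y)` is primitive if `y` is integral, and otherwise
  -- `(y⁻¹, 1)` is. A primitive row completes to an element of `GL₂(𝒪_E)`.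
  by_cases hyi : ValGE 0 y
  · refine ⟨⟨!![0, -1; 1, y], !![y, 1; -1, 0], ?_, ?_⟩, ?_, ?_, ?_⟩
    · ext i j; fin_cases i <;> fin_cases j <;> simp
    · ext i j; fin_cases i <;> fin_cases j <;> simp
    · rw [mem_EndLattice_iff]
      intro i j
      fin_cases i <;> fin_cases j <;> simp [valGE_zero, valGE_one, valGE_neg, hyi]
    · rw [mem_EndLattice_iff]
      intro i j
      fin_cases i <;> fin_cases j <;> simp [valGE_zero, valGE_one, valGE_neg, hyi]
    · rw [adj_eq hζ]
      simp [Matrix.mul_apply, Fin.sum_univ_two]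
      linear_combination key
  · have hy0 : y ≠ 0 := fun h => hyi (Or.inl h)
    have hy0' : σ y ≠ 0 := by simpa using hy0
    have hyi' : ValGE 0 y⁻¹ := by
      rw [valGE_of_ne hy0] at hyi
      exact Or.inr (by rw [val_inv]; omega)
    refine ⟨⟨!![1, 0; y⁻¹, 1], !![1, 0; -y⁻¹, 1], ?_, ?_⟩, ?_, ?_, ?_⟩
    · ext i j; fin_cases i <;> fin_cases j <;> simp
    · ext i j; fin_cases i <;> fin_cases j <;> simp
    · rw [mem_EndLattice_iff]
      intro i j
      fin_cases i <;> fin_cases j <;> simp [valGE_zero, valGE_one, hyi']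
    · rw [mem_EndLattice_iff]
      intro i j
      fin_cases i <;> fin_cases j <;> simp [valGE_zero, valGE_one, valGE_neg, hyi']
    · rw [adj_eq hζ]
      simp [Matrix.mul_apply, Fin.sum_univ_two]
      field_simp
      linear_combination key

/-- If `X X^* = Y Y^*` then `X⁻¹ Y` is unitary, so left invariance of `ν` makes the integral
independent of the chosen preimage. -/
theorem pushforward_eq_integral [MeasurableSpace (U2 σ ζ)] [BorelSpace (U2 σ ζ)]
    (ν : Measure (U2 σ ζ)) [ν.IsHaarMeasure] (f : Matrix (Fin 2) (Fin 2) E → ℂ)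
    {δ : Matrix (Fin 2) (Fin 2) E} {X : GL (Fin 2) E} (hX : X.1 * adj σ ζ X.1 = δ) :
    pushforward σ ζ ν f δ = ∫ u : U2 σ ζ, f (X.1 * u.1.1) ∂ν := by
  have hex : ∃ X : GL (Fin 2) E, X.1 * adj σ ζ X.1 = δ := ⟨X, hX⟩
  rw [pushforward, dif_pos hex]
  have hY := hex.choose_spec
  set Y := hex.choose
  have hinv : adj σ ζ X.1 * adj σ ζ (X⁻¹).1 = 1 := by
    rw [← adj_mul H.ne_zero, Units.inv_mul, adj_one H.ne_zero]
  have hu : X⁻¹ * Y ∈ U2 σ ζ := by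
    rw [mem_U2_iff H.ne_zero H.conj_conj, mul_eq_one_comm, Units.val_mul, adj_mul H.ne_zero,
      mul_assoc, ← mul_assoc Y.1, hY, ← hX, mul_assoc, hinv, mul_one, Units.inv_mul]
  rw [← integral_mul_left_eq_self (fun u : U2 σ ζ => f (X.1 * u.1.1)) ⟨_, hu⟩]
  congr 1
  ext u
  congr 1
  change Y.1 * u.1.1 = X.1 * (((X⁻¹).1 * Y.1) * u.1.1)
  rw [← mul_assoc, ← mul_assoc, Units.mul_inv, one_mul]

theorem even_val_det_of_eq {δ : Matrix (Fin 2) (Fin 2) E} {X : GL (Fin 2) E}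
    (hX : X.1 * adj σ ζ X.1 = δ) : Even (val E δ.det) := by
  have h0 : X.1.det ≠ 0 := (Matrix.isUnits_det_units X).ne_zero
  rw [← hX, Matrix.det_mul, det_adj H.ne_zero, val_mul h0 (by simpa using h0), H.val_conj]
  exact ⟨_, rfl⟩

/-- The volume of the set of `u ∈ U(V₂)` with `X u ∈ End(Λ)`, for an upper triangular `X`. -/
theorem measure_mul_mem_EndLattice [MeasurableSpace (U2 σ ζ)] [BorelSpace (U2 σ ζ)]
    (ν : Measure (U2 σ ζ)) [ν.IsHaarMeasure] (hν : ν (ULattice σ ζ) = 1)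
    {x : E} (hx : x ≠ 0) (l : F) (m : ℤ) (hm : ∀ k : ℤ, k ≤ val E x → (ValGE k l ↔ k ≤ m))
    (hmx : m ≤ val E x) :
    MeasurableSet {u : U2 σ ζ |
      !![x, algebraMap F E l * ζ / (2 * σ x); 0, 1] * u.1.1 ∈ EndLattice E} ∧
    ν {u : U2 σ ζ | !![x, algebraMap F E l * ζ / (2 * σ x); 0, 1] * u.1.1 ∈ EndLattice E} =
      ∑ t ∈ Finset.range (m + 1).toNat,
        (Nat.card (IsLocalRing.ResidueField (valuation F).integer) : ℝ≥0∞) ^ t := by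
  obtain ⟨p, hp0, hp⟩ := val_surjective (K := F) 1
  have hsx : σ x ≠ 0 := by simpa using hx
  have hwv : ∀ i : ℤ, val F (((Units.mk0 p hp0) ^ i : Fˣ) : F) = i := fun i => by
    rw [Units.val_zpow_eq_zpow_val, val_zpow, Units.val_mk0, hp, mul_one]
  have hw0 : ∀ i : ℤ, algebraMap F E (((Units.mk0 p hp0) ^ i : Fˣ) : F) ≠ 0 := fun i =>
    (map_ne_zero _).2 (Units.ne_zero _)
  have hP0 : Algebra.norm F x ≠ 0 := by
    intro h
    have := H.algebraMap_norm x
    rw [h, map_zero] at this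
    exact mul_ne_zero hx hsx this.symm
  have hPv : val F (Algebra.norm F x) = 2 * val E x := by
    rw [← H.unramified, H.algebraMap_norm, val_mul hx hsx, H.val_conj, two_mul]
  have := H.measure_setOf ν hν (p := Units.mk0 p hp0) hp
    (fun u => !![x, algebraMap F E l * ζ / (2 * σ x); 0, 1] * u.1.1 ∈ EndLattice E)
    (fun g k hk hg => by
      change _ * (g.1.1 * k.1.1) ∈ _
      rwa [← mul_assoc, mul_mem_EndLattice_iff hk]) (-val E x) (m - val E x) (by
    intro i z
    rw [mem_EndLattice_iff, borel_val]
    simp only [Fin.forall_fin_two, Matrix.mul_apply, Fin.sum_univ_two, Matrix.of_apply,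
      Matrix.cons_val', Matrix.cons_val_zero, Matrix.cons_val_one, Matrix.cons_val_fin_one,
      mul_zero, zero_mul, add_zero, zero_add, one_mul]
    have e1 : ValGE 0 (x * algebraMap F E (((Units.mk0 p hp0) ^ i : Fˣ) : F)) ↔ -val E x ≤ i := by
      rw [valGE_of_ne (mul_ne_zero hx (hw0 i)), val_mul hx (hw0 i), H.unramified, hwv]
      omega
    have e2 : ValGE 0 (algebraMap F E ((((Units.mk0 p hp0) ^ i : Fˣ) : F))⁻¹) ↔ i ≤ 0 := by
      rw [map_inv₀, valGE_of_ne (inv_ne_zero (hw0 i)), val_inv, H.unramified, hwv]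
      omega
    -- Up to the factor `x w⁻¹`, the corner is `z + (l / (2 Nm x)) ζ`, so its integrality separates
    -- into a condition on `z` and one on `l`.
    have e3 : x * algebraMap F E (z * ((((Units.mk0 p hp0) ^ i : Fˣ) : F))⁻¹) +
        algebraMap F E l * ζ / (2 * σ x) *
          algebraMap F E ((((Units.mk0 p hp0) ^ i : Fˣ) : F))⁻¹ =
        (algebraMap F E z + algebraMap F E (l * (2 * Algebra.norm F x)⁻¹) * ζ) *
          (x * algebraMap F E ((((Units.mk0 p hp0) ^ i : Fˣ) : F))⁻¹) := by
      have h2 := H.two_ne_zero'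
      have hw := hw0 i
      simp only [map_mul, map_inv₀, H.algebraMap_norm, map_ofNat]
      field_simp
    have hwi : algebraMap F E ((((Units.mk0 p hp0) ^ i : Fˣ) : F))⁻¹ ≠ 0 := by
      rw [map_inv₀]; exact inv_ne_zero (hw0 i)
    have hP2 : (2 * Algebra.norm F x)⁻¹ ≠ 0 := inv_ne_zero (mul_ne_zero H.two_ne_zero hP0)
    rw [e1, e2, e3, valGE_mul_iff (mul_ne_zero hx hwi), val_mul hx hwi, map_inv₀, val_inv,
      H.unramified, hwv, H.valGE_coord_iff, valGE_mul_iff hP2, val_inv,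
      val_mul H.two_ne_zero hP0, H.val_two, hPv,
      show (0 : ℤ) - (val E x + -i) - -(0 + 2 * val E x) = i + val E x by ring,
      show (0 : ℤ) - (val E x + -i) = i + -val E x by ring]
    constructor
    · rintro ⟨⟨h1, h2, h3⟩, -, h4⟩
      have := (hm (i + val E x) (by omega)).1 h3
      exact ⟨h1, by omega, h2⟩
    · rintro ⟨h1, h2, h3⟩
      exact ⟨⟨h1, h3, (hm _ (by omega)).2 (by omega)⟩, valGE_zero _, by omega⟩)
  rw [show m - val E x - -val E x + 1 = m + 1 by ring] at this
  exact this

theorem pushforward_eq_zero [MeasurableSpace (U2 σ ζ)] (ν : Measure (U2 σ ζ))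
    (f : Matrix (Fin 2) (Fin 2) E → ℂ) {δ : Matrix (Fin 2) (Fin 2) E}
    (hodd : ¬ Even (val E δ.det)) : pushforward σ ζ ν f δ = 0 := by
  rw [pushforward, dif_neg]
  rintro ⟨X, hX⟩
  exact hodd (H.even_val_det_of_eq hX)

-- After an integral change of basis `δ` is upper triangular with diagonal `x, σ x` and corner `lζ`.
-- Divisibility of `δ` by valuation `j` then means `j ≤ m`, with `m = min(val x, val l)`, and the
-- volume that computes the push-forward is `1 + ⋯ + q^m`.
open Classical in
theorem pushforward_eq_sum [MeasurableSpace (U2 σ ζ)] [BorelSpace (U2 σ ζ)]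
    (ν : Measure (U2 σ ζ)) [ν.IsHaarMeasure] (hν : ν (ULattice σ ζ) = 1)
    {δ : Matrix (Fin 2) (Fin 2) E} (hδ : δ ∈ Herm σ ζ) (h0 : δ.det ≠ 0)
    (hev : Even (val E δ.det)) (N : ℕ) (hN : val E δ.det < N) :
    pushforward σ ζ ν ((EndLattice E).indicator 1) δ =
      ∑ l ∈ Finset.range N, if EntriesGE l δ then
        (Nat.card (IsLocalRing.ResidueField (valuation F).integer) : ℂ) ^ l else 0 := by
  have hζ := H.ne_zero
  obtain ⟨k, hk, hk', h10⟩ := H.exists_isotropic hδ h0 hev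
  have hkinv : adj σ ζ k.1 * adj σ ζ (k⁻¹).1 = 1 := by
    rw [← adj_mul hζ, Units.inv_mul, adj_one hζ]
  have hδ' : k.1 * δ * adj σ ζ k.1 ∈ Herm σ ζ := by
    rw [mem_Herm_iff hζ H.conj_conj] at hδ ⊢
    rw [adj_mul hζ, adj_mul hζ, adj_adj hζ H.conj_conj, hδ, mul_assoc]
  have hback : (k⁻¹).1 * (k.1 * δ * adj σ ζ k.1) * adj σ ζ (k⁻¹).1 = δ := by
    rw [mul_assoc, mul_assoc, mul_assoc, hkinv, mul_one, ← mul_assoc, Units.inv_mul, one_mul]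
  obtain ⟨hkd, hkv⟩ := val_det_eq_zero hk hk'
  have hskd : σ k.1.det ≠ 0 := by simpa using hkd
  have hdet' : val E (k.1 * δ * adj σ ζ k.1).det = val E δ.det := by
    rw [Matrix.det_mul, Matrix.det_mul, det_adj hζ, val_mul (mul_ne_zero hkd h0) hskd,
      val_mul hkd h0, H.val_conj, hkv]
    ring
  have hent : ∀ j : ℤ, EntriesGE j δ ↔ EntriesGE j (k.1 * δ * adj σ ζ k.1) := by
    intro j
    constructor
    · intro h
      exact (EntriesGE.mul_left hk h).mul_right (H.adj_mem_EndLattice hk)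
    · intro h
      rw [← hback]
      exact (EntriesGE.mul_left hk' h).mul_right (H.adj_mem_EndLattice hk')
  have hdet0' : (k.1 * δ * adj σ ζ k.1).det ≠ 0 := by
    rw [Matrix.det_mul, Matrix.det_mul, det_adj hζ]
    exact mul_ne_zero (mul_ne_zero hkd h0) hskd
  obtain ⟨x, l, c, hform⟩ := H.exists_entries hδ'
  have hc : algebraMap F E c * ζ = 0 := by rw [← h10, hform]; simp
  rw [hc] at hform
  rw [hform] at hback hdet' hent hdet0'
  rw [Matrix.det_fin_two_of, mul_zero, sub_zero] at hdet' hdet0'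
  have hx : x ≠ 0 := left_ne_zero_of_mul hdet0'
  have hsx : σ x ≠ 0 := right_ne_zero_of_mul hdet0'
  rw [val_mul hx hsx, H.val_conj] at hdet'
  have h2 := H.two_ne_zero'
  -- In the corner of `X' X'^*` two equal terms add up to `lζ`, whence the factor `1/2`.
  let X' : GL (Fin 2) E := Matrix.GeneralLinearGroup.mkOfDetNeZero
    !![x, algebraMap F E l * ζ / (2 * σ x); 0, 1] (by simpa using hx)
  have hX'v : X'.1 = !![x, algebraMap F E l * ζ / (2 * σ x); 0, 1] := rfl
  have hX' : X'.1 * adj σ ζ X'.1 = !![x, algebraMap F E l * ζ; 0, σ x] := by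
    rw [hX'v, adj_eq hζ]
    ext i j
    fin_cases i <;> fin_cases j <;> simp
    rw [H.conj_conj, H.conj_eq, map_ofNat σ 2]
    field_simp
    ring
  have hX : (k⁻¹ * X').1 * adj σ ζ (k⁻¹ * X').1 = δ := by
    rw [Units.val_mul, adj_mul hζ, mul_assoc, ← mul_assoc X'.1, hX', ← mul_assoc, hback]
  obtain ⟨m, hmx, hm⟩ : ∃ m ≤ val E x, ∀ j : ℤ, j ≤ val E x → (ValGE j l ↔ j ≤ m) := by
    by_cases hl : l = 0
    · exact ⟨val E x, le_rfl, fun j hj => by simp [hl, valGE_zero, hj]⟩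
    · refine ⟨min (val E x) (val F l), min_le_left _ _, fun j hj => ?_⟩
      rw [valGE_of_ne hl]
      omega
  obtain ⟨hms, hvol⟩ := H.measure_mul_mem_EndLattice ν hν hx l m hm hmx
  have hfun : ∀ u : U2 σ ζ,
      ((EndLattice E).indicator 1 ((k⁻¹ * X').1 * u.1.1) : ℂ) =
      {u : U2 σ ζ | !![x, algebraMap F E l * ζ / (2 * σ x); 0, 1] * u.1.1 ∈ EndLattice E}.indicator
        (fun _ => (1 : ℂ)) u := by
    intro u
    have : (k⁻¹ * X').1 * u.1.1 ∈ EndLattice E ↔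
        !![x, algebraMap F E l * ζ / (2 * σ x); 0, 1] * u.1.1 ∈ EndLattice E := by
      rw [Units.val_mul, mul_assoc, ← hX'v]
      constructor
      · intro h
        have := mul_mem_EndLattice hk h
        rwa [← mul_assoc, Units.mul_inv, one_mul] at this
      · exact mul_mem_EndLattice hk'
    simp only [Set.indicator_apply, this, Set.mem_ofPred_eq, Pi.one_apply]
  rw [H.pushforward_eq_integral ν _ hX]
  simp only [hfun]
  rw [integral_indicator_const _ hms, Measure.real, hvol, ENNReal.toReal_sum (by simp),
    ← Finset.sum_filter]
  -- The cutoff `N` loses nothing: divisibility by valuation `j ≥ 0` forces `2j ≤ val (det δ) < N`.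
  have hS : (Finset.range N).filter (fun j : ℕ => EntriesGE (j : ℤ) δ) =
      Finset.range (m + 1).toNat := by
    ext j
    rw [Finset.mem_filter, Finset.mem_range, Finset.mem_range, hent]
    have : EntriesGE (j : ℤ) !![x, algebraMap F E l * ζ; 0, σ x] ↔
        (j : ℤ) ≤ val E x ∧ ValGE (j : ℤ) l := by
      simp only [EntriesGE, Fin.forall_fin_two, Matrix.of_apply, Matrix.cons_val',
        Matrix.cons_val_zero, Matrix.cons_val_one, Matrix.cons_val_fin_one, H.valGE_conj,
        H.valGE_mul_zeta, H.valGE_algebraMap, valGE_zero, valGE_of_ne hx]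
      tauto
    rw [this]
    constructor
    · rintro ⟨-, h1, h2⟩
      have := (hm _ h1).1 h2
      omega
    · intro h
      have h1 : (j : ℤ) ≤ m := by omega
      exact ⟨by omega, by omega, (hm _ (by omega)).2 h1⟩
  rw [hS]
  simp

end UnramifiedQuadratic

/-! ### Orbital integrals as integrals over the unitary group -/

section OrbitalIntegral

variable {F E : Type*} [Field F] [Field E] [Algebra F E] {σ : E ≃ₐ[F] E} {ζ : E}

theorem conj_inv_mul (u g : U2 σ ζ) (δ : Matrix (Fin 2) (Fin 2) E) :
    conj (g.1⁻¹) (conj u.1 δ) = conj ((u⁻¹ * g).1⁻¹) δ := by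
  rw [← conj_mul]
  congr 1

variable [MeasurableSpace (U2 σ ζ)]

theorem measurable_orbitFun {δ : Matrix (Fin 2) (Fin 2) E} {f : Matrix (Fin 2) (Fin 2) E → ℂ}
    (hf : Measurable fun g : U2 σ ζ => f (conj (g.1⁻¹) δ)) : Measurable (orbitFun σ ζ δ f) :=
  measurable_from_quotient.2 hf

/-- With `T_δ` of mass one the quotient measure is a push-forward, so unfolding leaves an integral
over the whole group. -/
theorem orb_eq_integral (ν : Measure (U2 σ ζ)) {δ : Matrix (Fin 2) (Fin 2) E}
    {f : Matrix (Fin 2) (Fin 2) E → ℂ}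
    (hf : Measurable fun g : U2 σ ζ => f (conj (g.1⁻¹) δ)) :
    orb σ ζ ν δ f = ∫ g : U2 σ ζ, f (conj (g.1⁻¹) δ) ∂ν := by
  rw [orb, quotientMeasure, integral_map measurable_quotient_mk''.aemeasurable
    (measurable_orbitFun hf).aestronglyMeasurable]
  rfl

theorem integrable_orbitFun (ν : Measure (U2 σ ζ)) {δ : Matrix (Fin 2) (Fin 2) E}
    {f : Matrix (Fin 2) (Fin 2) E → ℂ}
    (hf : Measurable fun g : U2 σ ζ => f (conj (g.1⁻¹) δ))
    (hi : Integrable (fun g : U2 σ ζ => f (conj (g.1⁻¹) δ)) ν) :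
    Integrable (orbitFun σ ζ δ f) (quotientMeasure (centralizer σ ζ δ) ν) := by
  rw [quotientMeasure, integrable_map_measure (measurable_orbitFun hf).aestronglyMeasurable
    measurable_quotient_mk''.aemeasurable]
  exact hi

end OrbitalIntegral

/-! ### Volumes of the sets where `g⁻¹ δ g` is divisible, and the integral of `Φ_n`. -/

namespace UnramifiedQuadratic

variable {F E : Type*}
  [Field F] [ValuativeRel F] [TopologicalSpace F] [IsNonarchimedeanLocalField F]
  [Field E] [ValuativeRel E] [TopologicalSpace E] [IsNonarchimedeanLocalField E]
  [Algebra F E] {σ : E ≃ₐ[F] E} {ζ : E} (H : UnramifiedQuadratic σ ζ)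
include H

/-- The expression is the norm of `x + yζ`, of valuation `2 min(val x, val y)`; `(k + 1) / 2` is `k
/ 2` rounded up. -/
theorem valGE_sq_sub {D : F} (hD : algebraMap F E D = ζ ^ 2) (k : ℤ) (x y : F) :
    ValGE k (x ^ 2 - D * y ^ 2) ↔ ValGE ((k + 1) / 2) x ∧ ValGE ((k + 1) / 2) y := by
  rw [← H.valGE_coord_iff, ← H.valGE_algebraMap]
  set w := algebraMap F E x + algebraMap F E y * ζ with hw
  have h : algebraMap F E (x ^ 2 - D * y ^ 2) = w * σ w := by
    rw [hw, H.conj_coord]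
    simp only [map_sub, map_mul, map_pow, map_neg, hD]
    ring
  rw [h]
  by_cases h0 : w = 0
  · simp [h0, valGE_zero]
  · have h0' : σ w ≠ 0 := by simpa using h0
    rw [valGE_of_ne (mul_ne_zero h0 h0'), val_mul h0 h0', H.val_conj, valGE_of_ne h0]
    omega

theorem deltaMat_mem_Herm (a m l : F) : deltaMat ζ a m l ∈ Herm σ ζ := by
  rw [mem_Herm_iff H.ne_zero H.conj_conj, adj_eq H.ne_zero, deltaMat]
  ext i j
  fin_cases i <;> fin_cases j <;> simp [H.conj_eq]

/-- The volume of the set of `g` for which `g⁻¹ δ g` is divisible by an element of valuation `k`. -/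
theorem measure_entriesGE_conj [MeasurableSpace (U2 σ ζ)] [BorelSpace (U2 σ ζ)]
    (ν : Measure (U2 σ ζ)) [ν.IsHaarMeasure] (hν : ν (ULattice σ ζ) = 1)
    {D : F} (hD : algebraMap F E D = ζ ^ 2) (hDv : val F D = 0) {a b m l : F} (hb : b ≠ 0)
    (h : m * l * D = b ^ 2) (k : ℤ) :
    MeasurableSet {g : U2 σ ζ | EntriesGE k (conj (g.1⁻¹) (deltaMat ζ a m l))} ∧
    (ValGE k a → ν {g : U2 σ ζ | EntriesGE k (conj (g.1⁻¹) (deltaMat ζ a m l))} =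
      ∑ t ∈ Finset.range ((2 * val F b - val F m - k) / 2 + (val F m - k) / 2 + 1).toNat,
        (Nat.card (IsLocalRing.ResidueField (valuation F).integer) : ℝ≥0∞) ^ t) ∧
    (¬ ValGE k a → ν {g : U2 σ ζ | EntriesGE k (conj (g.1⁻¹) (deltaMat ζ a m l))} = 0) := by
  by_cases ha : ValGE k a
  · have hm : m ≠ 0 := by
      rintro rfl
      rw [zero_mul, zero_mul] at h
      exact pow_ne_zero 2 hb h.symm
    have hD0 : D ≠ 0 := by
      rintro rfl
      rw [mul_zero] at h
      exact pow_ne_zero 2 hb h.symm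
    obtain ⟨p, hp0, hp⟩ := val_surjective (K := F) 1
    have hwv : ∀ i : ℤ, val F (((Units.mk0 p hp0) ^ i : Fˣ) : F) = i := fun i => by
      rw [Units.val_zpow_eq_zpow_val, val_zpow, Units.val_mk0, hp, mul_one]
    have hw0 : ∀ i : ℤ, (((Units.mk0 p hp0) ^ i : Fˣ) : F) ≠ 0 := fun i => Units.ne_zero _
    have key := H.measure_setOf ν hν (p := Units.mk0 p hp0) hp
      (fun g => EntriesGE k (conj (g.1⁻¹) (deltaMat ζ a m l)))
      (fun g u hu hg => by
        have e : conj ((g * u).1⁻¹) (deltaMat ζ a m l) =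
            (u.1⁻¹).1 * conj (g.1⁻¹) (deltaMat ζ a m l) * (u.1⁻¹⁻¹).1 := by
          change conj ((g.1 * u.1)⁻¹) _ = _
          rw [mul_inv_rev, conj_mul]; rfl
        rw [e, inv_inv]
        exact (EntriesGE.mul_left hu.2 hg).mul_right hu.1)
      (-((val F m - k) / 2)) ((2 * val F b - val F m - k) / 2) (by
      intro i z
      set w := (((Units.mk0 p hp0) ^ i : Fˣ) : F) with hw
      have hwE : algebraMap F E w ≠ 0 := (map_ne_zero _).2 (hw0 i)
      have hb2 : val F (b / (m * D)) = val F b - val F m := by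
        rw [val_div hb (mul_ne_zero hm hD0), val_mul hm hD0, hDv, add_zero]
      -- Writing `l` through `m` and `b` turns the upper right entry into a multiple of the norm
      -- form `z² - D (b / (mD))²`. It bounds `i` above and `val z` below, while the lower left
      -- entry bounds `i` below.
      have e : conj ((borel σ ζ (Units.mk0 p hp0 ^ i) z).1⁻¹) (deltaMat ζ a m l) =
          !![algebraMap F E a + algebraMap F E (-(z * m)) * ζ,
            algebraMap F E (-((z ^ 2 - D * (b / (m * D)) ^ 2) * (m * (w ^ 2)⁻¹))) * ζ;
            algebraMap F E (m * w ^ 2) * ζ, algebraMap F E a + algebraMap F E (z * m) * ζ] := by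
        have hl : l = m * D * (b / (m * D)) ^ 2 := by
          field_simp
          linear_combination h
        rw [conj, borel_inv_val, inv_inv, borel_val, deltaMat, ← hw]
        conv_lhs => rw [hl]
        have hmE : algebraMap F E m ≠ 0 := (map_ne_zero _).2 hm
        ext r s
        fin_cases r <;> fin_cases s <;> simp [Matrix.mul_apply, Fin.sum_univ_two] <;>
          (try simp only [Algebra.smul_def]) <;> field_simp <;> ring
      rw [e]
      simp only [EntriesGE, Fin.forall_fin_two, Matrix.of_apply, Matrix.cons_val',
        Matrix.cons_val_zero, Matrix.cons_val_one, Matrix.cons_val_fin_one, H.valGE_coord_iff,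
        H.valGE_mul_zeta, H.valGE_algebraMap, valGE_neg]
      have hmw : m * (w ^ 2)⁻¹ ≠ 0 := mul_ne_zero hm (inv_ne_zero (pow_ne_zero 2 (hw0 i)))
      rw [valGE_mul_iff hmw, H.valGE_sq_sub hD, valGE_mul_iff hm,
        valGE_of_ne (mul_ne_zero hm (pow_ne_zero 2 (hw0 i))), val_mul hm (pow_ne_zero 2 (hw0 i)),
        val_mul hm (inv_ne_zero (pow_ne_zero 2 (hw0 i))), val_inv, val_pow, hwv,
        valGE_of_ne (div_ne_zero hb (mul_ne_zero hm hD0)), hb2]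
      push_cast
      rw [show (k - (val F m + -(2 * i)) + 1) / 2 = i + -((val F m - k) / 2) by omega]
      constructor
      · rintro ⟨⟨h1, h2, h3⟩, h4, -⟩
        exact ⟨by omega, by omega, h2⟩
      · rintro ⟨h1, h2, h3⟩
        have h4 : ValGE (k - val F m) z := h3.mono (by omega)
        exact ⟨⟨⟨ha, h4⟩, h3, by omega⟩, by omega, ha, h4⟩)
    rw [sub_neg_eq_add] at key
    exact ⟨key.1, fun _ => key.2, fun h => absurd ha h⟩
  -- The trace `2a` is invariant under conjugation and `2` is a unit, so divisibility of any
  -- conjugate forces that of `a`.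
  · have hempty : {g : U2 σ ζ | EntriesGE k (conj (g.1⁻¹) (deltaMat ζ a m l))} = ∅ := by
      ext g
      simp only [Set.mem_ofPred_eq, Set.mem_empty_iff_false, iff_false]
      intro hg
      apply ha
      have h1 := (hg 0 0).add (hg 1 1)
      rw [← Matrix.trace_fin_two, trace_conj, deltaMat, Matrix.trace_fin_two_of, ← map_add,
        H.valGE_algebraMap, ← two_mul, valGE_mul_iff' H.two_ne_zero, H.val_two, sub_zero] at h1
      exact h1
    rw [hempty]
    exact ⟨MeasurableSet.empty, fun h => absurd h ha, fun _ => measure_empty⟩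

open Classical in
theorem phiN_conj_eq [MeasurableSpace (U2 σ ζ)] [BorelSpace (U2 σ ζ)]
    (ν : Measure (U2 σ ζ)) [ν.IsHaarMeasure] (hν : ν (ULattice σ ζ) = 1)
    {δ : Matrix (Fin 2) (Fin 2) E} (hδ : δ ∈ Herm σ ζ) (h0 : δ.det ≠ 0) {n : ℤ}
    (hn : val E δ.det = n) (N : ℕ) (hN : n < N) (g : U2 σ ζ) :
    PhiN σ ζ ν n (conj (g.1⁻¹) δ) = if Even n then
      ∑ l ∈ Finset.range N, (if EntriesGE l (conj (g.1⁻¹) δ) then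
        (Nat.card (IsLocalRing.ResidueField (valuation F).integer) : ℂ) ^ l else 0) else 0 := by
  have hH : conj (g.1⁻¹) δ ∈ Herm σ ζ := conj_mem_Herm H.ne_zero H.conj_conj hδ g⁻¹
  have hd := det_conj (g.1⁻¹) δ
  rw [PhiN, if_pos ⟨hH, by rwa [hd], by rwa [hd]⟩]
  split_ifs with hev
  · exact H.pushforward_eq_sum ν hν hH (by rwa [hd]) (by rwa [hd, hn]) N (by rwa [hd, hn])
  · exact H.pushforward_eq_zero ν _ (by rwa [hd, hn])

open Classical in
/-- The orbital integral of `Φ_n` at `(a, λζ; μζ, a)`. -/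
theorem integral_phiN [MeasurableSpace (U2 σ ζ)] [BorelSpace (U2 σ ζ)]
    (ν : Measure (U2 σ ζ)) [ν.IsHaarMeasure] (hν : ν (ULattice σ ζ) = 1)
    {D : F} (hD : algebraMap F E D = ζ ^ 2) (hDv : val F D = 0) {a b m l : F} (hb : b ≠ 0)
    (h : m * l * D = b ^ 2) (hadd : a + b ≠ 0) (hsub : a - b ≠ 0) {n : ℤ}
    (hn : n = val F ((a + b) * (a - b))) (N : ℕ) (hN : n < N) :
    Measurable (fun g : U2 σ ζ => PhiN σ ζ ν n (conj (g.1⁻¹) (deltaMat ζ a m l))) ∧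
    Integrable (fun g : U2 σ ζ => PhiN σ ζ ν n (conj (g.1⁻¹) (deltaMat ζ a m l))) ν ∧
    ∫ g : U2 σ ζ, PhiN σ ζ ν n (conj (g.1⁻¹) (deltaMat ζ a m l)) ∂ν = if Even n then
      ∑ k ∈ Finset.range N, (if ValGE (k : ℤ) a then
        ∑ t ∈ Finset.range ((2 * val F b - val F m - k) / 2 + (val F m - k) / 2 + 1).toNat,
          (Nat.card (IsLocalRing.ResidueField (valuation F).integer) : ℂ) ^ (k + t)
        else 0) else 0 := by
  have hdet : (deltaMat ζ a m l).det = algebraMap F E ((a + b) * (a - b)) := by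
    rw [deltaMat, Matrix.det_fin_two_of,
      show (a + b) * (a - b) = a * a - m * l * D by rw [h]; ring]
    simp only [map_sub, map_mul, hD]
    ring
  have hfun := H.phiN_conj_eq ν hν (H.deltaMat_mem_Herm a m l)
    (by rw [hdet]; exact (map_ne_zero _).2 (mul_ne_zero hadd hsub))
    (n := n) (by rw [hdet, H.unramified, hn]) N hN
  simp only [hfun]
  split_ifs with hev
  · have hms := fun k : ℕ => H.measure_entriesGE_conj ν hν hD hDv (a := a) hb h k
    have hind : ∀ (k : ℕ) (g : U2 σ ζ),
        (if EntriesGE k (conj (g.1⁻¹) (deltaMat ζ a m l)) then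
          (Nat.card (IsLocalRing.ResidueField (valuation F).integer) : ℂ) ^ k else 0) =
        {g : U2 σ ζ | EntriesGE k (conj (g.1⁻¹) (deltaMat ζ a m l))}.indicator (fun _ =>
          (Nat.card (IsLocalRing.ResidueField (valuation F).integer) : ℂ) ^ k) g := by
      intro k g
      rw [Set.indicator_apply]
      rfl
    have hfin : ∀ k : ℕ, ν {g : U2 σ ζ | EntriesGE k (conj (g.1⁻¹) (deltaMat ζ a m l))} ≠ ⊤ := by
      intro k
      by_cases ha : ValGE (k : ℤ) a
      · rw [(hms k).2.1 ha]
        exact (ENNReal.sum_lt_top.2 fun t _ => ENNReal.pow_lt_top (ENNReal.natCast_lt_top _)).ne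
      · rw [(hms k).2.2 ha]
        exact ENNReal.zero_ne_top
    simp only [hind]
    have hint := fun k : ℕ => (integrable_indicator_iff (hms k).1).2
      (integrableOn_const (C := (Nat.card (IsLocalRing.ResidueField (valuation F).integer) : ℂ) ^ k)
        (hs := hfin k))
    refine ⟨Finset.measurable_sum _ fun k _ => measurable_const.indicator (hms k).1,
      integrable_finsetSum _ fun k _ => hint k, ?_⟩
    rw [integral_finsetSum _ fun k _ => hint k]
    refine Finset.sum_congr rfl fun k _ => ?_
    rw [integral_indicator_const _ (hms k).1, Measure.real]
    split_ifs with ha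
    · rw [(hms k).2.1 ha, ENNReal.toReal_sum (by simp), Complex.real_smul, Complex.ofReal_sum,
        Finset.sum_mul]
      refine Finset.sum_congr rfl fun t _ => ?_
      simp [pow_add, mul_comm]
    · rw [(hms k).2.2 ha]
      simp
  · exact ⟨measurable_const, integrable_zero _ _ _, by simp⟩

end UnramifiedQuadratic

/-! ### Orthogonal eigenbases -/

section Eigenbasis

variable {F E : Type*} [Field F] [Field E] [Algebra F E] {σ : E ≃ₐ[F] E} {ζ : E}

theorem eq_of_forall_pairing_eq (hζ : ζ ≠ 0) {u v : Fin 2 → E}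
    (h : ∀ z, pairing σ ζ u z = pairing σ ζ v z) : u = v := by
  have h0 := h ![0, 1]
  have h1 := h ![1, 0]
  simp [pairing_eq, hζ] at h0 h1
  ext i
  fin_cases i
  · exact h0
  · exact h1

theorem pairing_conj (hσζ : σ ζ = -ζ) (hσ : ∀ z, σ (σ z) = z) (u v : Fin 2 → E) :
    σ (pairing σ ζ u v) = pairing σ ζ v u := by
  simp [pairing_eq, hσζ, hσ]
  ring

theorem pairing_smul_left (c : E) (u v : Fin 2 → E) :
    pairing σ ζ (c • u) v = σ c * pairing σ ζ u v := by
  simp [pairing_eq]; ring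

theorem pairing_smul_right (c : E) (u v : Fin 2 → E) :
    pairing σ ζ u (c • v) = c * pairing σ ζ u v := by
  simp [pairing_eq]; ring

/-- The columns of `Q` are orthogonal eigenvectors of `δ` for the eigenvalues `y` and `x`, with
Hermitian norms `α` and `β`. -/
structure IsEigenbasis (σ : E ≃ₐ[F] E) (ζ : E) (δ : Matrix (Fin 2) (Fin 2) E) (y x : F)
    (Q : GL (Fin 2) E) (α β : F) : Prop where
  mul_eq : δ * Q.1 = Q.1 * !![algebraMap F E y, 0; 0, algebraMap F E x]
  pairing_eq : ∀ u v, pairing σ ζ (Q.1 *ᵥ u) (Q.1 *ᵥ v) =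
    σ (u 0) * v 0 * algebraMap F E α + σ (u 1) * v 1 * algebraMap F E β
  mul_norm : algebraMap F E α * algebraMap F E β = Q.1.det * σ Q.1.det * ζ ^ 2

theorem IsEigenbasis.ne_zero {δ : Matrix (Fin 2) (Fin 2) E} {y x : F} {Q : GL (Fin 2) E} {α β : F}
    (hζ : ζ ≠ 0) (h : IsEigenbasis σ ζ δ y x Q α β) : α ≠ 0 ∧ β ≠ 0 := by
  have hd : Q.1.det ≠ 0 := (Matrix.isUnits_det_units Q).ne_zero
  have h1 : algebraMap F E α * algebraMap F E β ≠ 0 := by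
    rw [h.mul_norm]
    exact mul_ne_zero (mul_ne_zero hd (by simpa using hd)) (pow_ne_zero 2 hζ)
  exact ⟨(map_ne_zero _).1 (left_ne_zero_of_mul h1), (map_ne_zero _).1 (right_ne_zero_of_mul h1)⟩

theorem IsEigenbasis.exists_eq {δ : Matrix (Fin 2) (Fin 2) E} {y x : F} {Q : GL (Fin 2) E}
    {α β : F} (h : IsEigenbasis σ ζ δ y x Q α β) (hxy : x ≠ y) {v : Fin 2 → E}
    (hv : δ *ᵥ v = algebraMap F E y • v) : ∃ s : E, v = Q.1 *ᵥ ![s, 0] := by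
  obtain ⟨z, hz⟩ : ∃ z, v = Q.1 *ᵥ z :=
    ⟨(Q⁻¹).1 *ᵥ v, by rw [Matrix.mulVec_mulVec, Units.mul_inv, Matrix.one_mulVec]⟩
  refine ⟨z 0, ?_⟩
  rw [hz, Matrix.mulVec_mulVec, h.mul_eq, ← Matrix.mulVec_mulVec, ← Matrix.mulVec_smul] at hv
  have hv' := congrArg (fun w => (Q⁻¹).1 *ᵥ w) hv
  simp only [Matrix.mulVec_mulVec, Units.inv_mul, Matrix.one_mulVec] at hv'
  have h1 := congrFun hv' 1
  simp [Matrix.mulVec, dotProduct, Fin.sum_univ_two] at h1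
  have hz1 : z 1 = 0 := by
    rcases h1 with h1 | h1
    · exact absurd h1 hxy
    · exact h1
  rw [hz]
  congr 1
  ext i
  fin_cases i <;> simp [hz1]

/-- Operators with orthogonal eigenbases whose first norms agree up to a norm from `E` are
conjugate under the unitary group. -/
theorem IsEigenbasis.exists_conj_eq (hζ : ζ ≠ 0) {δ₁ δ₂ : Matrix (Fin 2) (Fin 2) E} {y x : F}
    {Q₁ Q₂ : GL (Fin 2) E} {α₁ α₂ β₁ β₂ : F} (h₁ : IsEigenbasis σ ζ δ₁ y x Q₁ α₁ β₁)
    (h₂ : IsEigenbasis σ ζ δ₂ y x Q₂ α₂ β₂) {s : E} (hs : s ≠ 0)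
    (h : algebraMap F E α₁ = s * σ s * algebraMap F E α₂) : ∃ u : U2 σ ζ, conj u.1 δ₁ = δ₂ := by
  have hd₁ : Q₁.1.det ≠ 0 := (Matrix.isUnits_det_units Q₁).ne_zero
  have hd₂ : Q₂.1.det ≠ 0 := (Matrix.isUnits_det_units Q₂).ne_zero
  -- The isometry scales the matched eigenvectors by `s` and `r`. This `r` gives it determinant one,
  -- and then `mul_norm` forces the second norms to match as well.
  obtain ⟨r, hr⟩ : ∃ r, r = Q₁.1.det / (s * Q₂.1.det) := ⟨_, rfl⟩
  have hr0 : r ≠ 0 := by rw [hr]; exact div_ne_zero hd₁ (mul_ne_zero hs hd₂)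
  have hsd₁ : σ Q₁.1.det ≠ 0 := by simpa using hd₁
  have hsd₂ : σ Q₂.1.det ≠ 0 := by simpa using hd₂
  have hss : σ s ≠ 0 := by simpa using hs
  have hα₂ : algebraMap F E α₂ ≠ 0 := (map_ne_zero _).2 (h₂.ne_zero hζ).1
  have hβ : algebraMap F E β₁ = r * σ r * algebraMap F E β₂ := by
    have e₁ := h₁.mul_norm
    have e₂ := h₂.mul_norm
    rw [h] at e₁
    rw [hr, map_div₀, map_mul]
    field_simp
    apply mul_left_cancel₀ hα₂
    linear_combination (Q₂.1.det * σ Q₂.1.det) * e₁ - (Q₁.1.det * σ Q₁.1.det) * e₂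
  let Δ : GL (Fin 2) E := Matrix.GeneralLinearGroup.mkOfDetNeZero !![s, 0; 0, r]
    (by simpa using ⟨hs, hr0⟩)
  have hΔ : Δ.1 = !![s, 0; 0, r] := rfl
  have hcomm : Δ.1 * !![algebraMap F E y, 0; 0, algebraMap F E x] =
      !![algebraMap F E y, 0; 0, algebraMap F E x] * Δ.1 := by
    rw [hΔ]
    ext i j
    fin_cases i <;> fin_cases j <;> simp [Algebra.smul_def, mul_comm]
  refine ⟨⟨Q₂ * Δ * Q₁⁻¹, ?_⟩, ?_⟩
  · intro u v
    obtain ⟨z, rfl⟩ : ∃ z, u = Q₁.1 *ᵥ z :=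
      ⟨(Q₁⁻¹).1 *ᵥ u, by rw [Matrix.mulVec_mulVec, Units.mul_inv, Matrix.one_mulVec]⟩
    obtain ⟨w, rfl⟩ : ∃ z, v = Q₁.1 *ᵥ z :=
      ⟨(Q₁⁻¹).1 *ᵥ v, by rw [Matrix.mulVec_mulVec, Units.mul_inv, Matrix.one_mulVec]⟩
    simp only [Units.val_mul, Matrix.mulVec_mulVec, mul_assoc, Units.inv_mul, mul_one]
    rw [← Matrix.mulVec_mulVec, ← Matrix.mulVec_mulVec, h₁.pairing_eq, h₂.pairing_eq, h, hβ, hΔ]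
    simp [Matrix.mulVec, dotProduct, Fin.sum_univ_two]
    ring
  · change conj (Q₂ * Δ * Q₁⁻¹) δ₁ = δ₂
    have e₁ : (Q₁⁻¹).1 * δ₁ * Q₁.1 = !![algebraMap F E y, 0; 0, algebraMap F E x] := by
      rw [mul_assoc, h₁.mul_eq, ← mul_assoc, Units.inv_mul, one_mul]
    have e₂ : Q₂.1 * !![algebraMap F E y, 0; 0, algebraMap F E x] * (Q₂⁻¹).1 = δ₂ := by
      rw [← h₂.mul_eq, mul_assoc, Units.mul_inv, mul_one]
    have e₃ : Δ.1 * !![algebraMap F E y, 0; 0, algebraMap F E x] * (Δ⁻¹).1 =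
        !![algebraMap F E y, 0; 0, algebraMap F E x] := by
      rw [hcomm, mul_assoc, Units.mul_inv, mul_one]
    rw [conj_mul, conj_mul]
    have e₁' : conj Q₁⁻¹ δ₁ = !![algebraMap F E y, 0; 0, algebraMap F E x] := by
      rw [conj, inv_inv]; exact e₁
    rw [e₁', conj.eq_1 Δ, e₃]
    exact e₂

end Eigenbasis

namespace UnramifiedQuadratic

variable {F E : Type*}
  [Field F] [ValuativeRel F] [TopologicalSpace F] [IsNonarchimedeanLocalField F]
  [Field E] [ValuativeRel E] [TopologicalSpace E] [IsNonarchimedeanLocalField E]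
  [Algebra F E] {σ : E ≃ₐ[F] E} {ζ : E} (H : UnramifiedQuadratic σ ζ)
include H

/-- Eigenvectors of a Hermitian operator for distinct eigenvalues in `F` are orthogonal, and
`mul_norm` is the Gram determinant of the eigenbasis. -/
theorem exists_isEigenbasis {δ : Matrix (Fin 2) (Fin 2) E} (hδ : δ ∈ Herm σ ζ) {y x : F}
    (hxy : x ≠ y) {Q : GL (Fin 2) E}
    (hQ : δ * Q.1 = Q.1 * !![algebraMap F E y, 0; 0, algebraMap F E x]) :
    ∃ α β : F, IsEigenbasis σ ζ δ y x Q α β := by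
  have hpc := pairing_conj H.conj_eq H.conj_conj
  set q₀ : Fin 2 → E := Q.1 *ᵥ ![1, 0]
  set q₁ : Fin 2 → E := Q.1 *ᵥ ![0, 1]
  have e₀ : δ *ᵥ q₀ = algebraMap F E y • q₀ := by
    rw [Matrix.mulVec_mulVec, hQ, ← Matrix.mulVec_mulVec, ← Matrix.mulVec_smul]
    congr 1
    ext i
    fin_cases i <;> simp [Matrix.mulVec, dotProduct, Fin.sum_univ_two]
  have e₁ : δ *ᵥ q₁ = algebraMap F E x • q₁ := by
    rw [Matrix.mulVec_mulVec, hQ, ← Matrix.mulVec_mulVec, ← Matrix.mulVec_smul]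
    congr 1
    ext i
    fin_cases i <;> simp [Matrix.mulVec, dotProduct, Fin.sum_univ_two]
  have h01 : pairing σ ζ q₀ q₁ = 0 := by
    have := hδ q₀ q₁
    rw [e₀, e₁, pairing_smul_left, pairing_smul_right, AlgEquiv.commutes] at this
    by_contra hne
    exact hxy ((algebraMap F E).injective (mul_right_cancel₀ hne this)).symm
  have h10 : pairing σ ζ q₁ q₀ = 0 := by rw [← hpc, h01, map_zero]
  obtain ⟨α, hα⟩ := H.exists_of_conj_eq (hpc q₀ q₀)
  obtain ⟨β, hβ⟩ := H.exists_of_conj_eq (hpc q₁ q₁)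
  refine ⟨α, β, hQ, ?_, ?_⟩
  · intro u v
    have hexp : ∀ u : Fin 2 → E, Q.1 *ᵥ u = u 0 • q₀ + u 1 • q₁ := by
      intro u
      rw [← Matrix.mulVec_smul, ← Matrix.mulVec_smul, ← Matrix.mulVec_add]
      congr 1
      ext i
      fin_cases i <;> simp
    have hbil : pairing σ ζ (Q.1 *ᵥ u) (Q.1 *ᵥ v) =
        σ (u 0) * v 0 * pairing σ ζ q₀ q₀ + σ (u 0) * v 1 * pairing σ ζ q₀ q₁ +
        σ (u 1) * v 0 * pairing σ ζ q₁ q₀ + σ (u 1) * v 1 * pairing σ ζ q₁ q₁ := by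
      rw [hexp u, hexp v]
      simp [pairing_eq]
      ring
    rw [hbil, h01, h10, hα, hβ]
    ring
  · have hdet : pairing σ ζ q₀ q₀ * pairing σ ζ q₁ q₁ - pairing σ ζ q₀ q₁ * pairing σ ζ q₁ q₀ =
        Q.1.det * σ Q.1.det * ζ ^ 2 := by
      simp [pairing_eq, q₀, q₁, Matrix.det_fin_two]
      ring
    rw [← hα, ← hβ, ← hdet, h01, zero_mul, sub_zero]

/-- The eigenvectors are `(b, -mζ)` and `(b, mζ)`. The norm of the first shows that, for fixed `a`
and `b`, the rational class depends on `m` modulo norms. -/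
theorem exists_isEigenbasis_deltaMat {D : F} (hD : algebraMap F E D = ζ ^ 2) {a b m l : F}
    (hb : b ≠ 0) (h : m * l * D = b ^ 2) : ∃ (Q : GL (Fin 2) E) (β : F),
      IsEigenbasis σ ζ (deltaMat ζ a m l) (a - b) (a + b) Q (-2 * b * D * m) β := by
  have hbE : algebraMap F E b ≠ 0 := (map_ne_zero _).2 hb
  have hm : m ≠ 0 := by
    rintro rfl
    rw [zero_mul, zero_mul] at h
    exact pow_ne_zero 2 hb h.symm
  have hmE : algebraMap F E m ≠ 0 := (map_ne_zero _).2 hm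
  have hE : algebraMap F E m * algebraMap F E l * ζ ^ 2 = algebraMap F E b ^ 2 := by
    rw [← hD, ← map_mul, ← map_mul, h, map_pow]
  let Q : GL (Fin 2) E := Matrix.GeneralLinearGroup.mkOfDetNeZero
    !![algebraMap F E b, algebraMap F E b; -(algebraMap F E m * ζ), algebraMap F E m * ζ] (by
      rw [Matrix.det_fin_two_of]
      have : algebraMap F E b * (algebraMap F E m * ζ) -
          algebraMap F E b * -(algebraMap F E m * ζ) =
          2 * (algebraMap F E b * (algebraMap F E m * ζ)) := by ring
      rw [this]
      exact mul_ne_zero H.two_ne_zero' (mul_ne_zero hbE (mul_ne_zero hmE H.ne_zero)))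
  have hQ : Q.1 =
    !![algebraMap F E b, algebraMap F E b; -(algebraMap F E m * ζ), algebraMap F E m * ζ] := rfl
  have hmul : deltaMat ζ a m l * Q.1 =
      Q.1 * !![algebraMap F E (a - b), 0; 0, algebraMap F E (a + b)] := by
    rw [hQ, deltaMat]
    ext i j
    fin_cases i <;> fin_cases j <;> simp [Algebra.smul_def]
    · linear_combination -hE
    · linear_combination hE
    · ring
    · ring
  have hxy : a + b ≠ a - b := by
    intro he
    have : 2 * b = 0 := by linear_combination he
    exact mul_ne_zero H.two_ne_zero hb this
  obtain ⟨α, β, hαβ⟩ := H.exists_isEigenbasis (H.deltaMat_mem_Herm a m l) hxy hmul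
  have hα : α = -2 * b * D * m := by
    apply (algebraMap F E).injective
    have := hαβ.pairing_eq ![1, 0] ![1, 0]
    simp [UnitaryOrbital.pairing_eq, hQ, H.conj_eq] at this
    simp only [map_mul, map_neg, map_ofNat, hD]
    linear_combination -this
  exact ⟨Q, β, hα ▸ hαβ⟩

theorem isEigenbasis_conj {δ δ' : Matrix (Fin 2) (Fin 2) E} (hδ' : δ' ∈ Herm σ ζ)
    {g : GL (Fin 2) E} (hg : conj g δ = δ') {y x : F} (hxy : x ≠ y) {Q : GL (Fin 2) E} {α β : F}
    (h : IsEigenbasis σ ζ δ y x Q α β) : ∃ α' β' : F, IsEigenbasis σ ζ δ' y x (g * Q) α' β' := by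
  apply H.exists_isEigenbasis hδ' hxy
  rw [← hg, conj, Units.val_mul, mul_assoc, ← mul_assoc (g⁻¹).1, Units.inv_mul, one_mul, mul_assoc,
    h.mul_eq, mul_assoc]

/-- The value of `κ` in terms of the Hermitian norms of the eigenvectors. -/
theorem kappaTilde_eq {δ δ' : Matrix (Fin 2) (Fin 2) E} {g : GL (Fin 2) E} {y x : F} (hxy : x ≠ y)
    {Q : GL (Fin 2) E} {α β α' β' : F} (h : IsEigenbasis σ ζ δ y x Q α β)
    (h' : IsEigenbasis σ ζ δ' y x (g * Q) α' β') :
    (IsNormUnit F E (α / α') → kappaTilde δ y (galCocycle σ ζ g) = 1) ∧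
    (¬ IsNormUnit F E (α / α') → kappaTilde δ y (galCocycle σ ζ g) = -1) := by
  have hζ := H.ne_zero
  obtain ⟨hα, -⟩ := h.ne_zero hζ
  obtain ⟨hα', -⟩ := h'.ne_zero hζ
  have hαE : algebraMap F E α ≠ 0 := (map_ne_zero _).2 hα
  have hαE' : algebraMap F E α' ≠ 0 := (map_ne_zero _).2 hα'
  have hu : IsUnit (adj σ ζ g.1).det := by
    rw [det_adj hζ, isUnit_iff_ne_zero]
    simpa using (Matrix.isUnits_det_units g).ne_zero
  -- The cocycle is the inverse of `g^* g`, which multiplies the `y`-eigenvector by the ratio `α' /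
  -- α` of its norms after and before applying `g`.
  have ht : galCocycle σ ζ g * (adj σ ζ g.1 * g.1) = 1 := by
    rw [galCocycle, mul_assoc, ← mul_assoc _ (adj σ ζ g.1), Matrix.nonsing_inv_mul _ hu, one_mul,
      Units.inv_mul]
  have ht' : (adj σ ζ g.1 * g.1) * galCocycle σ ζ g = 1 := mul_eq_one_comm.1 ht
  have hpair : ∀ u v, pairing σ ζ ((adj σ ζ g.1 * g.1) *ᵥ u) v =
      pairing σ ζ (g.1 *ᵥ u) (g.1 *ᵥ v) := by
    intro u v
    rw [← Matrix.mulVec_mulVec, ← pairing_mulVec hζ _ H.conj_conj]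
  constructor
  · intro hn
    rw [kappaTilde, if_pos]
    refine ⟨Q.1 *ᵥ ![1, 0], α / α', ?_, ?_, ?_, hn⟩
    · intro h0
      have := h.pairing_eq ![1, 0] ![1, 0]
      rw [h0] at this
      simp [UnitaryOrbital.pairing_eq] at this
      exact hαE this.symm
    · rw [Matrix.mulVec_mulVec, h.mul_eq, ← Matrix.mulVec_mulVec, ← Matrix.mulVec_smul]
      congr 1
      ext i
      fin_cases i <;> simp [Matrix.mulVec, dotProduct, Fin.sum_univ_two]
    · have e : (adj σ ζ g.1 * g.1) *ᵥ (Q.1 *ᵥ ![1, 0]) =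
          algebraMap F E (α' / α) • (Q.1 *ᵥ ![1, 0]) := by
        apply eq_of_forall_pairing_eq (σ := σ) hζ
        intro z
        obtain ⟨w, rfl⟩ : ∃ w, z = Q.1 *ᵥ w :=
          ⟨(Q⁻¹).1 *ᵥ z, by rw [Matrix.mulVec_mulVec, Units.mul_inv, Matrix.one_mulVec]⟩
        rw [hpair, pairing_smul_left, h.pairing_eq, Matrix.mulVec_mulVec, Matrix.mulVec_mulVec,
          ← Units.val_mul, h'.pairing_eq, AlgEquiv.commutes, map_div₀]
        simp
        field_simp
      have e' := congrArg (fun v => galCocycle σ ζ g *ᵥ v) e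
      simp only [Matrix.mulVec_smul] at e'
      rw [Matrix.mulVec_mulVec, ht, Matrix.one_mulVec] at e'
      conv_rhs => rw [e']
      rw [smul_smul, ← map_mul, div_mul_div_cancel₀ hα', div_self hα, map_one, one_smul]
  · intro hn
    rw [kappaTilde, if_neg]
    rintro ⟨v, c, hv0, hv, htv, hc⟩
    apply hn
    obtain ⟨s, rfl⟩ := h.exists_eq hxy hv
    have hs : s ≠ 0 := by
      rintro rfl
      apply hv0
      have : (![0, 0] : Fin 2 → E) = 0 := by ext i; fin_cases i <;> rfl
      rw [this, Matrix.mulVec_zero]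
    have hss : σ s ≠ 0 := by simpa using hs
    have e := congrArg (fun v => (adj σ ζ g.1 * g.1) *ᵥ v) htv
    simp only [Matrix.mulVec_smul] at e
    rw [Matrix.mulVec_mulVec (M := _) (N := galCocycle σ ζ g), ht', Matrix.one_mulVec] at e
    have e2 := congrArg (fun v => pairing σ ζ v (Q.1 *ᵥ ![s, 0])) e
    simp only [pairing_smul_left] at e2
    rw [hpair, h.pairing_eq, Matrix.mulVec_mulVec, ← Units.val_mul, h'.pairing_eq,
      AlgEquiv.commutes] at e2
    simp at e2
    have e3 : algebraMap F E α = algebraMap F E c * algebraMap F E α' := by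
      apply mul_left_cancel₀ (mul_ne_zero hss hs)
      linear_combination e2
    rw [← map_mul] at e3
    have e4 := (algebraMap F E).injective e3
    rwa [e4, mul_div_cancel_right₀ _ hα']

end UnramifiedQuadratic

/-! ### Summation -/

/-- The source of `c_±`: among `0, …, m` there are `(1 + m) / 2` odd and `(2 + m) / 2` even numbers.
-/
theorem sum_parity_indicator (z : ℂ) (M : ℤ) (m : ℕ) :
    ∑ k ∈ Finset.range (m + 1), (if Even (M - k) then 0 else z) =
      ((if Even M then (1 + m) / 2 else (2 + m) / 2 : ℕ) : ℂ) * z := by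
  induction m with
  | zero =>
    by_cases hM : Even M <;> simp [hM]
  | succ m ih =>
    rw [Finset.sum_range_succ, ih]
    have h : Even (M - ((m + 1 : ℕ) : ℤ)) ↔ (Even M ↔ Even (m + 1)) := by
      rw [Int.even_sub, Int.even_coe_nat]
    simp only [h]
    by_cases hM : Even M <;> by_cases hm : Even (m + 1) <;> simp only [hM, hm, if_true, if_false,
      iff_true, iff_false, not_true]
    · rw [show (1 + (m + 1)) / 2 = (1 + m) / 2 by rw [Nat.even_iff] at hm; omega, add_zero]
    · rw [show (1 + (m + 1)) / 2 = (1 + m) / 2 + 1 by rw [Nat.even_iff] at hm; omega]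
      push_cast; ring
    · rw [show (2 + (m + 1)) / 2 = (2 + m) / 2 + 1 by rw [Nat.even_iff] at hm; omega]
      push_cast; ring
    · rw [show (2 + (m + 1)) / 2 = (2 + m) / 2 by rw [Nat.even_iff] at hm; omega, add_zero]

/-- The two floors add up to `n - k`, or to one less when `M - k` is odd and both round down; in
that case the top term `z ^ n` is missing. -/
theorem sum_shifted_range (z : ℂ) (M : ℤ) {k n : ℕ} (hk : k ≤ n) :
    ∑ t ∈ Finset.range ((2 * n - M - k) / 2 + (M - k) / 2 + 1 : ℤ).toNat, z ^ (k + t) =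
      ∑ j ∈ Finset.Icc k n, z ^ j - if Even (M - k) then 0 else z ^ n := by
  have hIcc : Finset.Icc k n = Finset.Ico k (n + 1) := by
    ext; simp
  rw [hIcc, Finset.sum_Ico_eq_sum_range]
  split_ifs with h
  · rw [sub_zero, show ((2 * n - M - k) / 2 + (M - k) / 2 + 1 : ℤ).toNat = n + 1 - k by
      rw [Int.even_iff] at h; omega]
  · rw [show ((2 * n - M - k) / 2 + (M - k) / 2 + 1 : ℤ).toNat = n - k by
      rw [Int.even_iff] at h; omega, show n + 1 - k = (n - k) + 1 by omega,
      Finset.sum_range_succ, show k + (n - k) = n by omega, add_sub_cancel_right]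

/-- `P` is controlled only up to `n` because for `k > n` the inner sum is empty whether or not `P k`
holds. -/
theorem sum_shifted_range_eq (z : ℂ) (M : ℤ) {m n N : ℕ} (hmn : m ≤ n) (hmN : m < N)
    (P : ℕ → Prop) [DecidablePred P] (hP : ∀ k ≤ n, P k ↔ k ≤ m) :
    ∑ k ∈ Finset.range N, (if P k then
      ∑ t ∈ Finset.range ((2 * n - M - k) / 2 + (M - k) / 2 + 1 : ℤ).toNat, z ^ (k + t) else 0) =
    ∑ k ∈ Finset.range (m + 1), ∑ j ∈ Finset.Icc k n, z ^ j -
      ((if Even M then (1 + m) / 2 else (2 + m) / 2 : ℕ) : ℂ) * z ^ n := by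
  rw [← sum_parity_indicator, ← Finset.sum_sub_distrib,
    ← Finset.sum_subset (Finset.range_mono (show m + 1 ≤ N from hmN))]
  · refine Finset.sum_congr rfl fun k hk => ?_
    rw [Finset.mem_range] at hk
    rw [if_pos ((hP k (by omega)).2 (by omega)), sum_shifted_range z M (by omega)]
  · intro k hk hk'
    rw [Finset.mem_range] at hk'
    split_ifs with h
    · have hkn : n < k := by
        by_contra hle
        exact hk' (Nat.lt_succ_of_le ((hP k (by omega)).1 h))
      rw [show ((2 * n - M - k) / 2 + (M - k) / 2 + 1 : ℤ).toNat = 0 by omega]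
      simp
    · rfl

theorem finsum_quotient_pair {α : Type*} (S : Setoid α) (s₁ s₂ : α)
    (hcover : ∀ s, S.r s₁ s ∨ S.r s₂ s) (hne : ¬ S.r s₁ s₂) (f : α → ℂ) {z₁ z₂ : ℂ}
    (h₁ : ∀ s, S.r s₁ s → f s = z₁) (h₂ : ∀ s, S.r s₂ s → f s = z₂) :
    Finite (Quotient S) ∧ ∑ᶠ c : Quotient S, f c.out = z₁ + z₂ := by
  classical
  have hc : ∀ c : Quotient S, c = Quotient.mk S s₁ ∨ c = Quotient.mk S s₂ := by
    intro c
    induction c using Quotient.inductionOn with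
    | h s =>
      exact (hcover s).imp (fun h => Quotient.sound (S.symm' h))
        (fun h => Quotient.sound (S.symm' h))
  have hne' : Quotient.mk S s₁ ≠ Quotient.mk S s₂ := fun h => hne (Quotient.exact h)
  refine ⟨Finite.of_surjective
    (fun i : Bool => if i then Quotient.mk S s₁ else Quotient.mk S s₂) fun c => ?_, ?_⟩
  · rcases hc c with rfl | rfl
    · exact ⟨true, rfl⟩
    · exact ⟨false, rfl⟩
  · rw [finsum_eq_sum_of_support_subset (s := {Quotient.mk S s₁, Quotient.mk S s₂}) _
      (fun c _ => by simpa using hc c), Finset.sum_pair hne',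
      h₁ _ (S.symm' (Quotient.mk_out s₁)), h₂ _ (S.symm' (Quotient.mk_out s₂))]

theorem exists_min_val {F : Type*} [Field F] [ValuativeRel F] [TopologicalSpace F]
    [IsNonarchimedeanLocalField F] (a b : F) :
    ∃ r : ℤ, ∀ k : ℤ, ValGE k a ∧ k ≤ val F b ↔ k ≤ r := by
  by_cases ha : a = 0
  · exact ⟨val F b, fun k => by simp [ha, valGE_zero]⟩
  · exact ⟨min (val F a) (val F b), fun k => by rw [valGE_of_ne ha, le_min_iff]⟩

/-! ### Invariance of the orbital integral -/

section Conjugation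

variable {F E : Type*} [Field F] [Field E] [Algebra F E] {σ : E ≃ₐ[F] E} {ζ : E}
  [MeasurableSpace (U2 σ ζ)] [MeasurableMul (U2 σ ζ)]

theorem measurable_conj {δ : Matrix (Fin 2) (Fin 2) E} {f : Matrix (Fin 2) (Fin 2) E → ℂ}
    (hf : Measurable fun g : U2 σ ζ => f (conj (g.1⁻¹) δ)) (u : U2 σ ζ) :
    Measurable fun g : U2 σ ζ => f (conj (g.1⁻¹) (conj u.1 δ)) := by
  simp only [conj_inv_mul]
  exact hf.comp (measurable_const_mul u⁻¹)

theorem orb_conj (ν : Measure (U2 σ ζ)) [ν.IsMulLeftInvariant] {δ : Matrix (Fin 2) (Fin 2) E}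
    {f : Matrix (Fin 2) (Fin 2) E → ℂ}
    (hf : Measurable fun g : U2 σ ζ => f (conj (g.1⁻¹) δ)) (u : U2 σ ζ) :
    orb σ ζ ν (conj u.1 δ) f = orb σ ζ ν δ f := by
  rw [orb_eq_integral ν (measurable_conj hf u), orb_eq_integral ν hf]
  simp only [conj_inv_mul]
  exact integral_mul_left_eq_self (fun g : U2 σ ζ => f (conj (g.1⁻¹) δ)) u⁻¹

theorem integrable_orbitFun_conj (ν : Measure (U2 σ ζ)) [ν.IsMulLeftInvariant]
    {δ : Matrix (Fin 2) (Fin 2) E} {f : Matrix (Fin 2) (Fin 2) E → ℂ}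
    (hf : Measurable fun g : U2 σ ζ => f (conj (g.1⁻¹) δ))
    (hi : Integrable (fun g : U2 σ ζ => f (conj (g.1⁻¹) δ)) ν) (u : U2 σ ζ) :
    Integrable (orbitFun σ ζ (conj u.1 δ) f)
      (quotientMeasure (centralizer σ ζ (conj u.1 δ)) ν) := by
  apply integrable_orbitFun ν (measurable_conj hf u)
  simp only [conj_inv_mul]
  exact hi.comp_mul_left u⁻¹

end Conjugation

namespace UnramifiedQuadratic

variable {F E : Type*}
  [Field F] [ValuativeRel F] [TopologicalSpace F] [IsNonarchimedeanLocalField F]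
  [Field E] [ValuativeRel E] [TopologicalSpace E] [IsNonarchimedeanLocalField E]
  [Algebra F E] {σ : E ≃ₐ[F] E} {ζ : E} (H : UnramifiedQuadratic σ ζ)
include H

/-! ### Rational classes in the stable class -/

theorem exists_mul_conj_of_isNormUnit {α β : F} (hβ : β ≠ 0) (h : IsNormUnit F E (α / β)) :
    ∃ s : E, s ≠ 0 ∧ algebraMap F E α = s * σ s * algebraMap F E β := by
  obtain ⟨s, hs, he⟩ := h
  refine ⟨s, hs, ?_⟩
  rw [← H.algebraMap_norm, he, ← map_mul, div_mul_cancel₀ _ hβ]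

section Classes

variable {D : F} (hD : algebraMap F E D = ζ ^ 2) {a b m l m' l' : F} (hb : b ≠ 0)
  (h : m * l * D = b ^ 2) (h' : m' * l' * D = b ^ 2)
  (hm : Even (val F m)) (hm' : ¬ Even (val F m'))
include hD hb h h' hm hm'

/-- A unitary conjugation would carry the `y`-eigenvector to a `y`-eigenvector of the same norm,
making `m / m'` a norm, although its valuation is odd. -/
theorem not_conj_deltaMat (u : U2 σ ζ) : conj u.1 (deltaMat ζ a m l) ≠ deltaMat ζ a m' l' := by
  intro hu
  have hm0 : m ≠ 0 := by rintro rfl; rw [zero_mul, zero_mul] at h; exact pow_ne_zero 2 hb h.symm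
  have hm0' : m' ≠ 0 := by
    rintro rfl; rw [zero_mul, zero_mul] at h'; exact pow_ne_zero 2 hb h'.symm
  have hD0 : D ≠ 0 := by rintro rfl; rw [mul_zero] at h; exact pow_ne_zero 2 hb h.symm
  have hxy : a + b ≠ a - b := by
    intro he
    have : 2 * b = 0 := by linear_combination he
    exact mul_ne_zero H.two_ne_zero hb this
  obtain ⟨Q, β, hQ⟩ := H.exists_isEigenbasis_deltaMat hD (a := a) hb h
  obtain ⟨Q', β', hQ'⟩ := H.exists_isEigenbasis_deltaMat hD (a := a) hb h'
  have hev : (deltaMat ζ a m' l') *ᵥ ((u.1 * Q).1 *ᵥ ![1, 0]) =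
      algebraMap F E (a - b) • ((u.1 * Q).1 *ᵥ ![1, 0]) := by
    rw [← hu, conj, Matrix.mulVec_mulVec, Units.val_mul, mul_assoc, ← mul_assoc (u.1⁻¹).1,
      Units.inv_mul, one_mul, mul_assoc, hQ.mul_eq, ← mul_assoc, ← Matrix.mulVec_mulVec,
      ← Matrix.mulVec_smul]
    congr 1
    ext i
    fin_cases i <;> simp [Matrix.mulVec, dotProduct, Fin.sum_univ_two]
  obtain ⟨s, hs⟩ := hQ'.exists_eq hxy hev
  have e1 := u.2 (Q.1 *ᵥ ![1, 0]) (Q.1 *ᵥ ![1, 0])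
  rw [Matrix.mulVec_mulVec, ← Units.val_mul, hs, hQ'.pairing_eq, hQ.pairing_eq] at e1
  simp at e1
  rw [map_ofNat (algebraMap F E) 2] at e1
  have hc : (2 : E) * algebraMap F E b * algebraMap F E D ≠ 0 :=
    mul_ne_zero (mul_ne_zero H.two_ne_zero' ((map_ne_zero _).2 hb)) ((map_ne_zero _).2 hD0)
  have e2 : s * σ s * algebraMap F E m' = algebraMap F E m := by
    apply mul_left_cancel₀ hc
    linear_combination e1
  have hmE := (map_ne_zero (algebraMap F E)).2 hm0
  have hmE' := (map_ne_zero (algebraMap F E)).2 hm0'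
  have hs0 : s ≠ 0 := by
    rintro rfl
    rw [zero_mul, zero_mul] at e2
    exact hmE e2.symm
  have hs0' : σ s ≠ 0 := by simpa using hs0
  have e3 := congrArg (val E) e2
  rw [val_mul (mul_ne_zero hs0 hs0') hmE', val_mul hs0 hs0', H.val_conj, H.unramified,
    H.unramified] at e3
  rw [Int.even_iff] at hm hm'
  omega

/-- Every element of the stable class is conjugate to one of two representatives, as determined
by `κ`. -/
theorem kappaInv_eq (δ' : StableClass σ ζ (deltaMat ζ a m l)) :
    (kappaInv σ ζ (deltaMat ζ a m l) (a - b) δ' = 1 ∧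
      ∃ u : U2 σ ζ, conj u.1 (deltaMat ζ a m l) = δ'.1) ∨
    (kappaInv σ ζ (deltaMat ζ a m l) (a - b) δ' = -1 ∧
      ∃ u : U2 σ ζ, conj u.1 (deltaMat ζ a m' l') = δ'.1) := by
  have hxy : a + b ≠ a - b := by
    intro he
    have : 2 * b = 0 := by linear_combination he
    exact mul_ne_zero H.two_ne_zero hb this
  have hm0 : m ≠ 0 := by rintro rfl; rw [zero_mul, zero_mul] at h; exact pow_ne_zero 2 hb h.symm
  have hm0' : m' ≠ 0 := by
    rintro rfl; rw [zero_mul, zero_mul] at h'; exact pow_ne_zero 2 hb h'.symm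
  have hD0 : D ≠ 0 := by rintro rfl; rw [mul_zero] at h; exact pow_ne_zero 2 hb h.symm
  obtain ⟨Q, β, hQ⟩ := H.exists_isEigenbasis_deltaMat hD (a := a) hb h
  obtain ⟨Q', β', hQ'⟩ := H.exists_isEigenbasis_deltaMat hD (a := a) hb h'
  have hg := δ'.2.2.choose_spec
  obtain ⟨α₁, β₁, h₁⟩ := H.isEigenbasis_conj δ'.2.1 hg hxy hQ
  obtain ⟨hα₁, -⟩ := h₁.ne_zero H.ne_zero
  obtain ⟨k1, k2⟩ := H.kappaTilde_eq hxy hQ h₁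
  -- The ratios of the two representatives' norms to `α₁` differ by `m' / m`, of odd valuation.
  -- Exactly one of them is a norm, and it singles out the class of `δ'`.
  by_cases hn : IsNormUnit F E ((-2 * b * D * m) / α₁)
  · left
    refine ⟨k1 hn, ?_⟩
    obtain ⟨s, hs, he⟩ := H.exists_mul_conj_of_isNormUnit hα₁ hn
    exact hQ.exists_conj_eq H.ne_zero h₁ hs he
  · right
    refine ⟨k2 hn, ?_⟩
    have hc : -2 * b * D ≠ 0 := mul_ne_zero (mul_ne_zero (neg_ne_zero.2 H.two_ne_zero) hb) hD0
    have hn' : IsNormUnit F E ((-2 * b * D * m') / α₁) := by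
      rw [H.isNormUnit_iff (div_ne_zero (mul_ne_zero hc hm0) hα₁),
        val_div (mul_ne_zero hc hm0) hα₁, val_mul hc hm0, Int.even_iff] at hn
      rw [H.isNormUnit_iff (div_ne_zero (mul_ne_zero hc hm0') hα₁),
        val_div (mul_ne_zero hc hm0') hα₁, val_mul hc hm0', Int.even_iff]
      rw [Int.even_iff] at hm hm'
      omega
    obtain ⟨s, hs, he⟩ := H.exists_mul_conj_of_isNormUnit hα₁ hn'
    exact hQ'.exists_conj_eq H.ne_zero h₁ hs he

theorem finite_rationalClasses_and_orbKappa_eq [MeasurableSpace (U2 σ ζ)]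
    [MeasurableMul (U2 σ ζ)] (ν : Measure (U2 σ ζ)) [ν.IsMulLeftInvariant]
    (hst : StablyConj (deltaMat ζ a m l) (deltaMat ζ a m' l'))
    {f : Matrix (Fin 2) (Fin 2) E → ℂ}
    (hf : Measurable fun g : U2 σ ζ => f (conj (g.1⁻¹) (deltaMat ζ a m l)))
    (hf' : Measurable fun g : U2 σ ζ => f (conj (g.1⁻¹) (deltaMat ζ a m' l'))) :
    Finite (RationalClasses σ ζ (deltaMat ζ a m l)) ∧
    orbKappa σ ζ ν (deltaMat ζ a m l) (a - b) f =
      orb σ ζ ν (deltaMat ζ a m l) f - orb σ ζ ν (deltaMat ζ a m' l') f := by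
  have hcl := H.kappaInv_eq hD hb (a := a) h h' hm hm'
  have hnc := H.not_conj_deltaMat hD hb (a := a) h h' hm hm'
  have key := finsum_quotient_pair (rationalConj σ ζ (deltaMat ζ a m l))
    ⟨_, H.deltaMat_mem_Herm a m l, 1, conj_one _⟩ ⟨_, H.deltaMat_mem_Herm a m' l', hst⟩
    (fun s => (hcl s).imp And.right And.right) (fun ⟨u, hu⟩ => hnc u hu)
    (fun s => (kappaInv σ ζ (deltaMat ζ a m l) (a - b) s : ℂ) * orb σ ζ ν s.1 f)
    (z₁ := orb σ ζ ν (deltaMat ζ a m l) f) (z₂ := -orb σ ζ ν (deltaMat ζ a m' l') f) ?_ ?_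
  · rw [← sub_eq_add_neg] at key
    exact key
  · rintro s ⟨w, hw⟩
    rcases hcl s with ⟨hk, -⟩ | ⟨-, u, hu⟩
    · simp only [hk, ← hw, orb_conj ν hf, Int.cast_one, one_mul]
    · exfalso
      apply hnc (u⁻¹ * w)
      change conj (u.1⁻¹ * w.1) _ = _
      rw [conj_mul, hw, ← hu, ← conj_mul, inv_mul_cancel, conj_one]
  · rintro s ⟨w, hw⟩
    rcases hcl s with ⟨-, u, hu⟩ | ⟨hk, -⟩
    · exfalso
      apply hnc (w⁻¹ * u)
      change conj (w.1⁻¹ * u.1) _ = _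
      rw [conj_mul, hu, ← hw, ← conj_mul, inv_mul_cancel, conj_one]
    · simp only [hk, ← hw, orb_conj ν hf', Int.cast_neg, Int.cast_one, neg_one_mul]

end Classes

/-! ### Values of the orbital integrals -/

/-- Since `2` is a unit, `a ± b` and `a, b` generate the same fractional ideal. -/
theorem valGE_add_sub_iff {k : ℤ} {a b : F} :
    ValGE k (a + b) ∧ ValGE k (a - b) ↔ ValGE k a ∧ ValGE k b := by
  constructor
  · rintro ⟨h1, h2⟩
    have h3 := h1.add h2
    have h4 := h1.sub h2
    rw [show a + b + (a - b) = 2 * a by ring, valGE_mul_iff' H.two_ne_zero, H.val_two,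
      sub_zero] at h3
    rw [show a + b - (a - b) = 2 * b by ring, valGE_mul_iff' H.two_ne_zero, H.val_two,
      sub_zero] at h4
    exact ⟨h3, h4⟩
  · rintro ⟨h1, h2⟩
    exact ⟨h1.add h2, h1.sub h2⟩

/-- The orbital integral of `Φ_n`, in terms of the minimum `r` of the valuations of `a` and `b`. -/
theorem orb_phiN [MeasurableSpace (U2 σ ζ)] [BorelSpace (U2 σ ζ)]
    (ν : Measure (U2 σ ζ)) [ν.IsHaarMeasure] (hν : ν (ULattice σ ζ) = 1)
    {D : F} (hD : algebraMap F E D = ζ ^ 2) (hDv : val F D = 0) {a b m l : F} (hb : b ≠ 0)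
    (h : m * l * D = b ^ 2) (hadd : a + b ≠ 0) (hsub : a - b ≠ 0) {n : ℤ}
    (hn : n = val F ((a + b) * (a - b))) {r : ℤ}
    (hr : ∀ k : ℤ, ValGE k a ∧ k ≤ val F b ↔ k ≤ r) :
    Measurable (fun g : U2 σ ζ => PhiN σ ζ ν n (conj (g.1⁻¹) (deltaMat ζ a m l))) ∧
    Integrable (fun g : U2 σ ζ => PhiN σ ζ ν n (conj (g.1⁻¹) (deltaMat ζ a m l))) ν ∧
    (Even n → 0 ≤ r → orb σ ζ ν (deltaMat ζ a m l) (PhiN σ ζ ν n) =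
      (∑ k ∈ Finset.range (r.toNat + 1), ∑ j ∈ Finset.Icc k (val F b).toNat,
        (Nat.card (IsLocalRing.ResidueField (valuation F).integer) : ℂ) ^ j) -
      ((if Even (val F m) then (1 + r.toNat) / 2 else (2 + r.toNat) / 2 : ℕ) : ℂ) *
        (Nat.card (IsLocalRing.ResidueField (valuation F).integer) : ℂ) ^ (val F b).toNat) ∧
    (¬ (Even n ∧ 0 ≤ r) → orb σ ζ ν (deltaMat ζ a m l) (PhiN σ ζ ν n) = 0) := by
  classical
  obtain ⟨h1, h2, h3⟩ := H.integral_phiN ν hν hD hDv hb h hadd hsub hn (n.toNat + 1) (by omega)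
  have hrb : r ≤ val F b := ((hr r).2 le_rfl).2
  -- This makes the cutoff `n.toNat + 1` exceed `r.toNat`, so that no contributing `k` is cut off.
  have hrn : 2 * r ≤ n := by
    have ha : ValGE r a := ((hr r).2 le_rfl).1
    obtain ⟨h4, h5⟩ := H.valGE_add_sub_iff.2 ⟨ha, (valGE_of_ne hb).2 hrb⟩
    rw [valGE_of_ne hadd] at h4
    rw [valGE_of_ne hsub] at h5
    rw [hn, val_mul hadd hsub]
    omega
  refine ⟨h1, h2, fun hev hr0 => ?_, fun hne => ?_⟩
  · rw [orb_eq_integral ν h1, h3, if_pos hev]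
    have hbn : val F b = ((val F b).toNat : ℤ) := by omega
    have := sum_shifted_range_eq (Nat.card (IsLocalRing.ResidueField (valuation F).integer) : ℂ)
      (val F m) (m := r.toNat) (n := (val F b).toNat) (N := n.toNat + 1) (by omega) (by omega)
      (fun k => ValGE (k : ℤ) a) (fun k hk => by
        constructor
        · intro hka
          have := (hr k).1 ⟨hka, by omega⟩
          omega
        · intro hkr
          exact ((hr k).2 (by omega)).1)
    rw [← hbn] at this
    exact this
  · rw [orb_eq_integral ν h1, h3]
    split_ifs with hev
    · apply Finset.sum_eq_zero
      intro k _
      split_ifs with hka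
      -- Here `r < 0 ≤ k` while `k ≤ val a` or `a = 0`, so `k > val b` and the inner sum is empty.
      · have hkb : val F b < k := by
          by_contra hle
          have := (hr k).1 ⟨hka, by omega⟩
          exact hne ⟨hev, by omega⟩
        rw [show ((2 * val F b - val F m - k) / 2 + (val F m - k) / 2 + 1 : ℤ).toNat = 0 by omega]
        simp
      · rfl
    · rfl

end UnramifiedQuadratic

end UnitaryOrbital

end

/-! ### The main theorem: the difference of the two orbital integrals, and the case distinction. -/

theorem mainTheorem4
    {F E : Type*}
    [Field F] [ValuativeRel F] [TopologicalSpace F] [IsNonarchimedeanLocalField F]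
    [Field E] [ValuativeRel E] [TopologicalSpace E] [IsNonarchimedeanLocalField E]
    [Algebra F E] [ValuativeExtension F E]
    (hdeg : Module.finrank F E = 2)
    (hunr : UnitaryOrbital.IsUnramified F E)
    (hodd : ringChar (IsLocalRing.ResidueField (ValuativeRel.valuation F).integer) ≠ 2)
    (σ : E ≃ₐ[F] E) (hσ : σ ≠ AlgEquiv.refl)
    (ζ : E) (hζ0 : ζ ≠ 0) (hζ : UnitaryOrbital.val E ζ = 0) (hσζ : σ ζ = -ζ)
    [MeasurableSpace (UnitaryOrbital.U2 σ ζ)] [BorelSpace (UnitaryOrbital.U2 σ ζ)]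
    (ν : MeasureTheory.Measure (UnitaryOrbital.U2 σ ζ)) [ν.IsHaarMeasure]
    (hν : ν (UnitaryOrbital.ULattice σ ζ) = 1)
    (q : ℕ)
    (hq : q = Nat.card (IsLocalRing.ResidueField (ValuativeRel.valuation F).integer))
    (a b : F) (hb : b ≠ 0) (hadd : a + b ≠ 0) (hsub : a - b ≠ 0)
    (n : ℤ) (hn : n = UnitaryOrbital.val F ((a + b) * (a - b)))
    (μp lp μm lm : F)
    (δp δm : Matrix (Fin 2) (Fin 2) E)
    (hδp : δp = UnitaryOrbital.deltaMat ζ a μp lp)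
    (hδm : δm = UnitaryOrbital.deltaMat ζ a μm lm)
    (hηp : UnitaryOrbital.eta F E μp = 1)
    (hηm : UnitaryOrbital.eta F E μm = -1)
    (hstp : UnitaryOrbital.StablyConj δp
      !![algebraMap F E (a + b), 0; 0, algebraMap F E (a - b)])
    (hstm : UnitaryOrbital.StablyConj δm
      !![algebraMap F E (a + b), 0; 0, algebraMap F E (a - b)]) :
    -- the sums and integrals below converge
    (Finite (UnitaryOrbital.RationalClasses σ ζ δp) ∧
      ∀ δ' : UnitaryOrbital.StableClass σ ζ δp,
        MeasureTheory.Integrable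
          (UnitaryOrbital.orbitFun σ ζ δ'.1 (UnitaryOrbital.PhiN σ ζ ν n))
          (UnitaryOrbital.quotientMeasure (UnitaryOrbital.centralizer σ ζ δ'.1) ν)) ∧
    -- the `κ`-orbital integral
    ((Even (UnitaryOrbital.val F (a + b)) ∧ Even (UnitaryOrbital.val F (a - b)) ∧
        0 ≤ UnitaryOrbital.val F (a + b) ∧ 0 ≤ UnitaryOrbital.val F (a - b) →
      UnitaryOrbital.orbKappa σ ζ ν δp (a - b) (UnitaryOrbital.PhiN σ ζ ν n) =
        (q : ℂ) ^ UnitaryOrbital.val F b) ∧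
     (¬ (Even (UnitaryOrbital.val F (a + b)) ∧ Even (UnitaryOrbital.val F (a - b)) ∧
        0 ≤ UnitaryOrbital.val F (a + b) ∧ 0 ≤ UnitaryOrbital.val F (a - b)) →
      UnitaryOrbital.orbKappa σ ζ ν δp (a - b) (UnitaryOrbital.PhiN σ ζ ν n) = 0)) ∧
    -- the individual orbital integrals, case `val a > val b`
    (∀ n₂ : ℕ, UnitaryOrbital.val F b = n₂ → (a = 0 ∨ (n₂ : ℤ) < UnitaryOrbital.val F a) →
      n = 2 * n₂ ∧
      UnitaryOrbital.orb σ ζ ν δp (UnitaryOrbital.PhiN σ ζ ν n) =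
        (∑ k ∈ Finset.range (n₂ + 1), ∑ j ∈ Finset.Icc k n₂, (q : ℂ) ^ j)
          - (((1 + n₂) / 2 : ℕ) : ℂ) * (q : ℂ) ^ n₂ ∧
      UnitaryOrbital.orb σ ζ ν δm (UnitaryOrbital.PhiN σ ζ ν n) =
        (∑ k ∈ Finset.range (n₂ + 1), ∑ j ∈ Finset.Icc k n₂, (q : ℂ) ^ j)
          - (((2 + n₂) / 2 : ℕ) : ℂ) * (q : ℂ) ^ n₂) ∧
    -- case `val a < val b`
    (∀ n₁ n₂ : ℕ, a ≠ 0 → UnitaryOrbital.val F a = n₁ → UnitaryOrbital.val F b = n₂ → n₁ < n₂ →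
      n = 2 * n₁ ∧
      UnitaryOrbital.orb σ ζ ν δp (UnitaryOrbital.PhiN σ ζ ν n) =
        (∑ k ∈ Finset.range (n₁ + 1), ∑ j ∈ Finset.Icc k n₂, (q : ℂ) ^ j)
          - (((1 + n₁) / 2 : ℕ) : ℂ) * (q : ℂ) ^ n₂ ∧
      UnitaryOrbital.orb σ ζ ν δm (UnitaryOrbital.PhiN σ ζ ν n) =
        (∑ k ∈ Finset.range (n₁ + 1), ∑ j ∈ Finset.Icc k n₂, (q : ℂ) ^ j)
          - (((2 + n₁) / 2 : ℕ) : ℂ) * (q : ℂ) ^ n₂) ∧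
    -- case `val a = val b`
    (∀ n₂ : ℕ, a ≠ 0 → UnitaryOrbital.val F a = n₂ → UnitaryOrbital.val F b = n₂ →
      2 * (n₂ : ℤ) ≤ n ∧
      (Odd n →
        UnitaryOrbital.orb σ ζ ν δp (UnitaryOrbital.PhiN σ ζ ν n) = 0 ∧
        UnitaryOrbital.orb σ ζ ν δm (UnitaryOrbital.PhiN σ ζ ν n) = 0) ∧
      (Even n →
        UnitaryOrbital.orb σ ζ ν δp (UnitaryOrbital.PhiN σ ζ ν n) =
          (∑ k ∈ Finset.range (n₂ + 1), ∑ j ∈ Finset.Icc k n₂, (q : ℂ) ^ j)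
            - (((1 + n₂) / 2 : ℕ) : ℂ) * (q : ℂ) ^ n₂ ∧
        UnitaryOrbital.orb σ ζ ν δm (UnitaryOrbital.PhiN σ ζ ν n) =
          (∑ k ∈ Finset.range (n₂ + 1), ∑ j ∈ Finset.Icc k n₂, (q : ℂ) ^ j)
            - (((2 + n₂) / 2 : ℕ) : ℂ) * (q : ℂ) ^ n₂)) := by
  classical
  have H : UnitaryOrbital.UnramifiedQuadratic σ ζ := ⟨hdeg, hunr, hodd, hσ, hζ0, hζ, hσζ⟩
  obtain ⟨D, hD, hD0, hDv, -⟩ := H.exists_sq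
  subst hδp hδm hq
  -- Stable conjugacy preserves the determinant: `a² - mlD = a² - b²`.
  have hdet : ∀ m l : F, UnitaryOrbital.StablyConj (UnitaryOrbital.deltaMat ζ a m l)
      !![algebraMap F E (a + b), 0; 0, algebraMap F E (a - b)] → m * l * D = b ^ 2 := by
    rintro m l ⟨g, hg⟩
    have h1 := UnitaryOrbital.det_conj g (UnitaryOrbital.deltaMat ζ a m l)
    rw [hg, UnitaryOrbital.deltaMat, Matrix.det_fin_two_of, Matrix.det_fin_two_of] at h1
    apply (algebraMap F E).injective
    simp only [map_mul, map_pow, hD, map_add, map_sub] at h1 ⊢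
    linear_combination h1
  have hp := hdet μp lp hstp
  have hm := hdet μm lm hstm
  have hp0 : μp ≠ 0 := by rintro rfl; rw [zero_mul, zero_mul] at hp; exact pow_ne_zero 2 hb hp.symm
  have hm0 : μm ≠ 0 := by rintro rfl; rw [zero_mul, zero_mul] at hm; exact pow_ne_zero 2 hb hm.symm
  have hpe : Even (UnitaryOrbital.val F μp) := by
    rw [← H.isNormUnit_iff hp0]
    by_contra hne
    rw [UnitaryOrbital.eta, if_neg hne] at hηp
    norm_num at hηp
  have hme : ¬ Even (UnitaryOrbital.val F μm) := by
    rw [← H.isNormUnit_iff hm0]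
    intro hne
    rw [UnitaryOrbital.eta, if_pos hne] at hηm
    norm_num at hηm
  have hst : UnitaryOrbital.StablyConj (UnitaryOrbital.deltaMat ζ a μp lp)
      (UnitaryOrbital.deltaMat ζ a μm lm) := by
    obtain ⟨g, hg⟩ := hstp
    obtain ⟨g', hg'⟩ := hstm
    refine ⟨g'⁻¹ * g, ?_⟩
    rw [UnitaryOrbital.conj_mul, hg, ← hg', ← UnitaryOrbital.conj_mul, inv_mul_cancel,
      UnitaryOrbital.conj_one]
  obtain ⟨r, hr⟩ := UnitaryOrbital.exists_min_val a b
  obtain ⟨mp, ip, vp, zp⟩ := H.orb_phiN ν hν hD hDv hb hp hadd hsub hn hr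
  obtain ⟨mm, im, vm, zm⟩ := H.orb_phiN ν hν hD hDv hb hm hadd hsub hn hr
  rw [if_pos hpe] at vp
  rw [if_neg hme] at vm
  obtain ⟨hfin, hkappa⟩ :=
    H.finite_rationalClasses_and_orbKappa_eq hD hb hp hm hpe hme ν hst mp mm
  have hrb : r ≤ UnitaryOrbital.val F b := ((hr r).2 le_rfl).2
  -- So `r` is also the smaller of `val (a + b)` and `val (a - b)`, which carries parity information
  -- from these to `r`.
  have hmin : ∀ k : ℤ, k ≤ UnitaryOrbital.val F (a + b) ∧ k ≤ UnitaryOrbital.val F (a - b) ↔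
      k ≤ r := by
    intro k
    rw [← UnitaryOrbital.valGE_of_ne hadd, ← UnitaryOrbital.valGE_of_ne hsub,
      H.valGE_add_sub_iff, UnitaryOrbital.valGE_of_ne hb, hr]
  have hmin₀ := (hmin r).2 le_rfl
  have hmin₁ := mt (hmin (r + 1)).1 (by omega)
  have hnv : n = UnitaryOrbital.val F (a + b) + UnitaryOrbital.val F (a - b) := by
    rw [hn, UnitaryOrbital.val_mul hadd hsub]
  refine ⟨⟨hfin, ?_⟩, ⟨?_, ?_⟩, ?_, ?_, ?_⟩
  · intro δ'
    rcases H.kappaInv_eq hD hb hp hm hpe hme δ' with ⟨-, u, hu⟩ | ⟨-, u, hu⟩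
    · rw [← hu]
      exact UnitaryOrbital.integrable_orbitFun_conj ν mp ip u
    · rw [← hu]
      exact UnitaryOrbital.integrable_orbitFun_conj ν mm im u
  · rintro ⟨h1, h2, h3, h4⟩
    have hr0 : 0 ≤ r := (hmin 0).1 ⟨h3, h4⟩
    have hne : Even n := by rw [hnv]; exact h1.add h2
    rw [hkappa, vp hne hr0, vm hne hr0]
    -- As `r` is one of two even valuations, it is even, and `c_- - c_+ = 1`.
    have hre : (2 + r.toNat) / 2 = (1 + r.toNat) / 2 + 1 := by
      rw [Int.even_iff] at h1 h2
      omega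
    rw [hre, show UnitaryOrbital.val F b = ((UnitaryOrbital.val F b).toNat : ℤ) by omega,
      zpow_natCast]
    push_cast
    simp only [Int.toNat_natCast]
    ring
  · intro hnot
    rw [hkappa]
    by_cases hc : Even n ∧ 0 ≤ r
    · rw [vp hc.1 hc.2, vm hc.1 hc.2]
      -- With `n` even and `r ≥ 0`, the condition can fail only if both valuations are odd; then `r`
      -- is odd and `c_- = c_+`.
      have hre : (2 + r.toNat) / 2 = (1 + r.toNat) / 2 := by
        obtain ⟨h1, h2⟩ := hc
        rw [hnv] at h1
        rw [Int.even_iff] at h1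
        rw [Int.even_iff, Int.even_iff] at hnot
        omega
      rw [hre, sub_self]
    · rw [zp hc, zm hc, sub_self]
  · intro n₂ hn₂ ha
    -- Here `b` dominates, so `val (a + b) = val (a - b) = val b` and `n = 2 n₂`.
    have haGE : UnitaryOrbital.ValGE (UnitaryOrbital.val F b + 1) a := by
      rcases ha with rfl | ha
      · exact UnitaryOrbital.valGE_zero _
      · exact Or.inr (by omega)
    have hrn : r = n₂ := by
      have := (hr n₂).1 ⟨haGE.mono (by omega), by omega⟩
      omega
    have e1 := (UnitaryOrbital.val_eq_of_sub (y := a + b) hb (by simpa using haGE)).2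
    have e2 := (UnitaryOrbital.val_eq_of_sub (x := -b) (y := a - b) (neg_ne_zero.2 hb) (by
      rw [UnitaryOrbital.val_neg]; simpa using haGE)).2
    rw [UnitaryOrbital.val_neg] at e2
    have hn2 : n = 2 * n₂ := by omega
    have hne : Even n := ⟨n₂, by omega⟩
    have t1 : r.toNat = n₂ := by omega
    have t2 : (UnitaryOrbital.val F b).toNat = n₂ := by omega
    have hvp := vp hne (by omega)
    have hvm := vm hne (by omega)
    rw [t1, t2] at hvp hvm
    exact ⟨hn2, hvp, hvm⟩
  · intro n₁ n₂ ha hn₁ hn₂ hlt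
    have hrn : r = n₁ := by
      have h1 := (hr n₁).1 ⟨Or.inr (by omega), by omega⟩
      have h2 := ((hr r).2 le_rfl).1
      rw [UnitaryOrbital.valGE_of_ne ha] at h2
      omega
    have hbGE : UnitaryOrbital.ValGE (UnitaryOrbital.val F a + 1) b := Or.inr (by omega)
    have e1 := (UnitaryOrbital.val_eq_of_sub (y := a + b) ha (by simpa using hbGE)).2
    have e2 := (UnitaryOrbital.val_eq_of_sub (y := a - b) ha (by simpa using hbGE.neg)).2
    have hn2 : n = 2 * n₁ := by omega
    have hne : Even n := ⟨n₁, by omega⟩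
    have t1 : r.toNat = n₁ := by omega
    have t2 : (UnitaryOrbital.val F b).toNat = n₂ := by omega
    have hvp := vp hne (by omega)
    have hvm := vm hne (by omega)
    rw [t1, t2] at hvp hvm
    exact ⟨hn2, hvp, hvm⟩
  · intro n₂ ha hn₁ hn₂
    have hrn : r = n₂ := by
      have := (hr n₂).1 ⟨Or.inr (by omega), by omega⟩
      omega
    have t1 : r.toNat = n₂ := by omega
    have t2 : (UnitaryOrbital.val F b).toNat = n₂ := by omega
    refine ⟨by omega, fun hno => ?_, fun hne => ?_⟩
    · have hno' : ¬ (Even n ∧ 0 ≤ r) := fun h => Int.not_even_iff_odd.2 hno h.1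
      exact ⟨zp hno', zm hno'⟩
    · have hvp := vp hne (by omega)
      have hvm := vm hne (by omega)
      rw [t1, t2] at hvp hvm
      exact ⟨hvp, hvm⟩
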